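/- Let $d\ge 1$, $m\ge 0$ and let $b\ge 2$ be an even integer. For $\ell\ge 0$ put $t^\ell_i=i/2^\ell$ ($i\in\mathbb Z$), let $\mathcal C^\ell_d$ be the set of the cells $\prod_{j=1}^d[t^\ell_{i_j},t^\ell_{i_j+1}]$, and let $B^\ell_{d,m}$ be the set of the tensor product B-splines of degree $m$ over the knots $t^\ell_i$; $\mathrm{supp}\,\beta$ is the open box $(t^\ell_{i_1},t^\ell_{i_1+m+1})\times\dots\times(t^\ell_{i_d},t^\ell_{i_d+m+1})$ for $\beta\in B^\ell_{d,m}$ of index $(i_1,\dots,i_d)$ (that is, the interior of $\{\beta\ne0\}$). Let $\mathbb R^d=\Omega^0\supseteq\Omega^1\supseteq\dots\supseteq\Omega^{N-1}\supseteq\Omega^N=\varnothing$ be a hierarchical mesh: $\Omega^{N-1}\neq\varnothing$ and each $\Omega^\ell$, $1\le\ell\le N-1$, is a union of cells from $\mathcal C^{\ell-1}_d$. Put $\mathcal M^{-1}=\varnothing$, $\mathcal M^\ell=\mathbb R^d\setminus\mathrm{int}\,\Omega^{\ell+1}$, and $$\mathcal K^\ell=\{\beta\in B^\ell_{d,m}\mid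 \mathrm{supp}\,\beta\cap\mathcal M^{\ell-1}=\varnothing,\ \mathrm{supp}\,\beta\cap\mathcal M^\ell\ne\varnothing\},\qquad 0\le\ell\le N-1 .$$ For $\beta\in B^\ell_{d,m}$ let $c_\beta\in\mathcal C^\ell_d$ be the central cell of $\mathrm{supp}\,\beta$ if $m+1$ is odd, and the cell whose lower left corner (the vertex with all coordinates least) is the central vertex of $\mathrm{supp}\,\beta$ if $m+1$ is even. Encode $z\in\mathbb Z[1/b]$ with $|z|=\sum_{i=1}^k\alpha_ib^{i-1}+\sum_{i=1}^k\beta_ib^{-i}$ (base-$b$ digits, $k$ least possible) by the word $(z)_b=\binom{s}{s}\binom{\alpha_1}{\beta_1}\cdots\binom{\alpha_k}{\beta_k}$, with $s=0$ if $z\ge0$ and $s=1$ if $z<0$, and $\overline z\in\mathbb Z[1/b]^d$ by the convolution $(\overline z)_b=(z_1)_b\otimes\dots\otimes(z_d)_b$ (the words are written in parallel and padded at the end by a new symbol). Let $\mathcal L_b^d$ be the set of all $(\overline z)_b$ and $add_d$ the addition that it inherits from $\mathbb Z[1/b]^d$. With $\overline z_c$ the barycentre of a cell $c$, put $$L_\ell=\{(\overline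 z_c)_b\mid c\in\mathcal C^{\ell-1}_d,\ c\subseteq\Omega^\ell\},\quad \widetilde L^d_\ell=\{(\overline z_c)_b\mid c\in\mathcal C^\ell_d\},\quad \widehat L_\ell=\{(\overline z_{c_\beta})_b\mid\beta\in\mathcal K^\ell\}.$$ The mesh is called regular if $L_1,\dots,L_{N-1}$ are regular languages. Let $I_m=\{-\frac m2,\dots,\frac m2\}^d$ if $m+1$ is odd and $I_m=\{-\frac{m+1}2,\dots,\frac{m-1}2\}^d$ if $m+1$ is even; let $t^\ell_{\overline i}=(\overline i/2^\ell)_b$ and $r^\ell_{\overline i j}=(\overline i/2^\ell+\overline s^{\ell+1}_j)_b$ for $\overline i\in I_m$, where $\overline s^{\ell+1}_1,\dots,\overline s^{\ell+1}_{2^d}$ are the vectors $(\pm\frac1{2^{\ell+1}},\dots,\pm\frac1{2^{\ell+1}})$. Over the structure with domain $\mathcal L_b^d$, the function $add_d$, the unary relations $\widetilde L^d_\ell$ and $L_\ell$, and the constants $t^\ell_{\overline i}$ and $r^\ell_{\overline i j}$, consider the first-order formulas in one free variable $u$: $$\Psi_\ell=\bigvee_{\overline i\in I_m}\neg\bigl(add_d(u,t^\ell_{\overline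 i})\in L_{\ell+1}\bigr),\qquad \Theta_0=(u\in\widetilde L^d_0)\wedge\Psi_0,$$ $$\Gamma_\ell=(u\in\widetilde L^d_\ell)\wedge\bigwedge_{\overline i\in I_m}\bigvee_{j=1}^{2^d}\bigl(add_d(u,r^\ell_{\overline i j})\in L_\ell\bigr),\qquad \Theta_\ell=\Gamma_\ell\wedge\Psi_\ell\qquad(\ell>0),$$ and, for the mesh with $N=1$ only, $\Gamma_0=(u\in\widetilde L^d_0)$. Then: 1. $\widehat L_\ell$ is defined by $\Theta_\ell$ for $0\le\ell\le N-2$, and $\widehat L_{N-1}$ is defined by $\Gamma_{N-1}$. 2. If the mesh is regular, then $\widehat L_0,\dots,\widehat L_{N-1}$ are regular. 3. For fixed $b,d,m$ there is an algorithm that from deterministic finite automata recognizing $L_1,\dots,L_{N-1}$, for any $N$ and any such regular mesh, constructs deterministic finite automata recognizing $\widehat L_0,\dots,\widehat L_{N-1}$. -/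

import Mathlib

open Set FirstOrder

noncomputable section

namespace HMesh

/-! ### Knots, cells and B-splines -/

/-- The knot `t^ℓ_i = i / 2^ℓ`. -/
def knot (ℓ : ℕ) (i : ℤ) : ℝ := i / 2 ^ ℓ

/-- The closed cube `∏ⱼ [t^ℓ_{i_j}, t^ℓ_{i_j+1}]`, a cell of the grid of level `ℓ`. -/
def cell {d : ℕ} (ℓ : ℕ) (i : Fin d → ℤ) : Set (Fin d → ℝ) :=
  Icc (fun j => knot ℓ (i j)) (fun j => knot ℓ (i j + 1))

/-- The set of all cells of the grid of level `ℓ`. -/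
def cells (d ℓ : ℕ) : Set (Set (Fin d → ℝ)) := range (cell ℓ)

/-- The univariate B-spline `N^ℓ_{i,m}` of degree `m`, by the Cox-de Boor recursion. -/
def bspline (ℓ : ℕ) : ℕ → ℤ → ℝ → ℝ
  | 0, i, x => Set.indicator (Ico (knot ℓ i) (knot ℓ (i + 1))) 1 x
  | j + 1, i, x =>
      (x - knot ℓ i) / (knot ℓ (i + (j + 1)) - knot ℓ i) * bspline ℓ j i x +
      (knot ℓ (i + (j + 1) + 1) - x) / (knot ℓ (i + (j + 1) + 1) - knot ℓ (i + 1)) *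
        bspline ℓ j (i + 1) x

/-- The tensor product B-spline `P^ℓ_{i,m}`. -/
def tensorBspline {d : ℕ} (ℓ m : ℕ) (i : Fin d → ℤ) : (Fin d → ℝ) → ℝ :=
  fun x => ∏ j, bspline ℓ m (i j) (x j)

/-- The set `B^ℓ_{d,m}` of all tensor product B-splines of level `ℓ` and degree `m`. -/
def tensorBsplines (d ℓ m : ℕ) : Set ((Fin d → ℝ) → ℝ) := range (tensorBspline ℓ m)

/-- The (open) support of a B-spline. For degree `m ≥ 1` the set `{x | β x ≠ 0}` is already an open
box; for `m = 0` it is half-open, and the interior makes it the open box as well. -/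
def support {d : ℕ} (β : (Fin d → ℝ) → ℝ) : Set (Fin d → ℝ) := interior {x | β x ≠ 0}

/-- The index of the cell associated with the tensor product B-spline of index `i`: the central
cell of the support if `m + 1` is odd, and the cell whose lower left corner is the central vertex of
the support if `m + 1` is even. -/
def assocIndex {d : ℕ} (m : ℕ) (i : Fin d → ℤ) : Fin d → ℤ :=
  if Odd (m + 1) then fun j => i j + (m / 2 : ℕ) else fun j => i j + ((m + 1) / 2 : ℕ)

end HMesh

/-! ### Hierarchical meshes and Kraft's selection mechanism -/

/-- A nested sequence of domains `Ω⁰ = ℝᵈ ⊇ Ω¹ ⊇ … ⊇ Ω^{N-1} ⊇ Ω^N = ∅` with `Ω^{N-1} ≠ ∅`, each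
`Ω^ℓ` (`1 ≤ ℓ ≤ N - 1`) being a union of cells of level `ℓ - 1`. The sequence is continued by `∅`
beyond `N`. -/
structure HierarchicalMesh (d N : ℕ) where
  Ω : ℕ → Set (Fin d → ℝ)
  zero : Ω 0 = univ
  anti : Antitone Ω
  top : ∀ ℓ, N ≤ ℓ → Ω ℓ = ∅
  top_nonempty : (Ω (N - 1)).Nonempty
  composed : ∀ ℓ, ℓ + 1 < N → ∃ M ⊆ HMesh.cells d ℓ, Ω (ℓ + 1) = ⋃₀ M

namespace HierarchicalMesh

/-- The set `𝓜^{ℓ-1} = ℝᵈ \ int Ω^ℓ`. For `ℓ = 0` this is `𝓜^{-1} = ∅`, because `Ω⁰ = ℝᵈ`. -/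
def prevRing {d N : ℕ} (T : HierarchicalMesh d N) (ℓ : ℕ) : Set (Fin d → ℝ) :=
  univ \ interior (T.Ω ℓ)

/-- Kraft's selection: the set `𝓚^ℓ` of all `β ∈ B^ℓ_{d,m}` whose support does not meet `𝓜^{ℓ-1}`
but meets `𝓜^ℓ`. -/
def kraft {d N : ℕ} (T : HierarchicalMesh d N) (m ℓ : ℕ) : Set ((Fin d → ℝ) → ℝ) :=
  {β ∈ HMesh.tensorBsplines d ℓ m |
    HMesh.support β ∩ T.prevRing ℓ = ∅ ∧ HMesh.support β ∩ T.prevRing (ℓ + 1) ≠ ∅}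

end HierarchicalMesh

namespace HMesh

/-! ### Words for elements of `ℤ[1/b]` and `ℤ[1/b]ᵈ` -/

/-- The group `ℤ[1/b]` of all rationals `s / b^k`. -/
def zinv (b : ℕ) [NeZero b] : AddSubgroup ℚ where
  carrier := {q | ∃ (s : ℤ) (k : ℕ), q = s / (b : ℚ) ^ k}
  zero_mem' := ⟨0, 0, by simp⟩
  add_mem' := by
    rintro _ _ ⟨s, k, rfl⟩ ⟨s', k', rfl⟩
    have hb : (b : ℚ) ≠ 0 := by exact_mod_cast NeZero.ne b
    refine ⟨s * b ^ k' + s' * b ^ k, k + k', ?_⟩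
    push_cast
    field_simp
    ring
  neg_mem' := by
    rintro _ ⟨s, k, rfl⟩
    exact ⟨-s, k, by push_cast; ring⟩

theorem dyadic_mem_zinv (b : ℕ) [NeZero b] [h : Fact (2 ∣ b)] (i : ℤ) (ℓ : ℕ) :
    (i : ℚ) / 2 ^ ℓ ∈ zinv b := by
  obtain ⟨a, ha⟩ := h.out
  have hb : (b : ℚ) = 2 * a := by exact_mod_cast ha
  have hb0 : (b : ℚ) ≠ 0 := by exact_mod_cast NeZero.ne b
  have ha0 : (a : ℚ) ≠ 0 := by rintro h0; simp [hb, h0] at hb0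
  refine ⟨i * a ^ ℓ, ℓ, ?_⟩
  push_cast
  rw [hb, mul_pow]
  field_simp

/-- The alphabet `Σ_b` of pairs of digits. -/
abbrev Digits (b : ℕ) : Type := Fin b × Fin b

/-- The pair `(α_{i+1}, β_{i+1})` of digits in base `b` of
`|z| = ∑_{i ≥ 1} α_i b^{i-1} + ∑_{i ≥ 1} β_i b^{-i}`. -/
def digitPair (b : ℕ) [NeZero b] (z : ℚ) (i : ℕ) : Digits b :=
  (Fin.ofNat b (⌊|z|⌋₊ / b ^ i), Fin.ofNat b ⌊|z| * (b : ℚ) ^ (i + 1)⌋₊)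

/-- The least `k` such that all digits at positions beyond `k` are zero. -/
def numDigits (b : ℕ) [NeZero b] (z : ℚ) : ℕ := sInf {k | ∀ i, k ≤ i → digitPair b z i = (0, 0)}

/-- The word `(z)_b`: a sign symbol, `(0,0)` if `z ≥ 0` and `(1,1)` if `z < 0`, followed by the
digit pairs of `|z|`. -/
def word (b : ℕ) [NeZero b] (z : zinv b) : List (Digits b) :=
  (if (z : ℚ) < 0 then (Fin.ofNat b 1, Fin.ofNat b 1) else (0, 0)) ::
    List.ofFn (fun i : Fin (numDigits b z) => digitPair b z i)

/-- The alphabet `Σ_⋄^k \ {(⋄, …, ⋄)}`, with `none` as the padding symbol `⋄`. -/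
abbrev Padded (σ : Type) (k : ℕ) : Type := {s : Fin k → Option σ // ∃ j, s j ≠ none}

/-- The convolution `w_1 ⊗ ⋯ ⊗ w_k`. -/
def convolution {σ : Type} {k : ℕ} (w : Fin k → List σ) : List (Padded σ k) :=
  List.ofFn (n := Finset.univ.sup fun j => (w j).length) fun i =>
    ⟨fun j => (w j)[(i : ℕ)]?, by
      obtain ⟨j, -, hj⟩ := Finset.lt_sup_iff.mp i.2
      exact ⟨j, by simpa using hj⟩⟩

/-- The word `(z)_b = (z_1)_b ⊗ ⋯ ⊗ (z_d)_b` of `z ∈ ℤ[1/b]ᵈ`. -/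
def wordVec (b : ℕ) [NeZero b] {d : ℕ} (z : Fin d → zinv b) : List (Padded (Digits b) d) :=
  convolution fun j => word b (z j)

/-- The language `𝓛_b^d`. -/
def allWords (b d : ℕ) [NeZero b] : Language (Padded (Digits b) d) :=
  range (wordVec b (d := d))

/-- The domain `𝓛_b^d` of the structure, as a type. -/
abbrev Carrier (b d : ℕ) [NeZero b] : Type := {w : List (Padded (Digits b) d) // w ∈ allWords b d}

/-- The inverse `ψ_b^d` of the bijection `z ↦ (z)_b`. -/
def decode (b d : ℕ) [NeZero b] (u : Carrier b d) : Fin d → zinv b := u.2.choose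

/-- The element of `𝓛_b^d` that represents `z`. -/
def encode (b : ℕ) [NeZero b] {d : ℕ} (z : Fin d → zinv b) : Carrier b d :=
  ⟨wordVec b z, mem_range_self z⟩

/-- The addition `add_d` in `𝓛_b^d`. -/
def addWords (b d : ℕ) [NeZero b] (u v : Carrier b d) : Carrier b d :=
  encode b (decode b d u + decode b d v)

/-- The vector `i / 2^ℓ` of `ℤ[1/b]ᵈ`, for `i ∈ ℤᵈ`. -/
def gridVec (b : ℕ) [NeZero b] [Fact (2 ∣ b)] {d : ℕ} (ℓ : ℕ) (i : Fin d → ℤ) : Fin d → zinv b :=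
  fun j => ⟨(i j : ℚ) / 2 ^ ℓ, dyadic_mem_zinv b (i j) ℓ⟩

/-- The barycentre of the cell of level `ℓ` and index `i`; its coordinates are
`(t^ℓ_{i_j} + t^ℓ_{i_j+1}) / 2 = (2 i_j + 1) / 2^{ℓ+1}`. -/
def barycentre (b : ℕ) [NeZero b] [Fact (2 ∣ b)] {d : ℕ} (ℓ : ℕ) (i : Fin d → ℤ) :
    Fin d → zinv b :=
  gridVec b (ℓ + 1) fun j => 2 * i j + 1

/-- The vector `(±1/2^ℓ, …, ±1/2^ℓ)` with the given signs (`true` for `+`). -/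
def signVec (b : ℕ) [NeZero b] [Fact (2 ∣ b)] {d : ℕ} (ℓ : ℕ) (ε : Fin d → Bool) :
    Fin d → zinv b :=
  gridVec b ℓ fun j => if ε j then 1 else -1

/-- The language `L̃_ℓ^d` of the barycentres of all cells of level `ℓ`. -/
def cellLang (b d : ℕ) [NeZero b] [Fact (2 ∣ b)] (ℓ : ℕ) : Language (Padded (Digits b) d) :=
  {w | ∃ i : Fin d → ℤ, w = wordVec b (barycentre b ℓ i)}

end HMesh

namespace HierarchicalMesh

open HMesh

/-- The language `L_{ℓ+1}` of the barycentres of the cells of level `ℓ` contained in `Ω^{ℓ+1}`. -/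
def domainLang (b : ℕ) [NeZero b] [Fact (2 ∣ b)] {d N : ℕ} (T : HierarchicalMesh d N) (ℓ : ℕ) :
    Language (Padded (Digits b) d) :=
  {w | ∃ i : Fin d → ℤ, cell ℓ i ⊆ T.Ω (ℓ + 1) ∧ w = wordVec b (barycentre b ℓ i)}

/-- The mesh is regular (in base `b`): the languages `L_1, …, L_{N-1}` are regular. -/
def IsRegular (b : ℕ) [NeZero b] [Fact (2 ∣ b)] {d N : ℕ} (T : HierarchicalMesh d N) : Prop :=
  ∀ ℓ, ℓ + 1 < N → (T.domainLang b ℓ).IsRegular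

/-- The language `L̂_ℓ` of the barycentres of the cells associated with the B-splines of level `ℓ`
chosen by Kraft's selection mechanism. -/
def kraftLang (b : ℕ) [NeZero b] [Fact (2 ∣ b)] {d N : ℕ} (T : HierarchicalMesh d N) (m ℓ : ℕ) :
    Language (Padded (Digits b) d) :=
  {w | ∃ i : Fin d → ℤ, tensorBspline ℓ m i ∈ T.kraft m ℓ ∧
    w = wordVec b (barycentre b ℓ (assocIndex m i))}

end HierarchicalMesh

namespace HMesh

/-! ### The first-order structure and the formulas -/

/-- The index set `I_m ⊆ ℤᵈ`: the cube `[-m/2, m/2]ᵈ` if `m + 1` is odd, and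
`[-(m+1)/2, (m-1)/2]ᵈ` if `m + 1` is even. -/
def indexCube (d m : ℕ) : Finset (Fin d → ℤ) :=
  Fintype.piFinset fun _ =>
    if Odd (m + 1) then Finset.Icc (-((m : ℤ) / 2)) ((m : ℤ) / 2)
    else Finset.Icc (-(((m : ℤ) + 1) / 2)) (((m : ℤ) - 1) / 2)

/-- Function symbols: addition `add_d` and constants for `t^ℓ_i` and `r^ℓ_{ij}`. The `2^d` values
of `j` are the sign patterns. -/
inductive Func (d m : ℕ) : ℕ → Type
  | add : Func d m 2
  | t (ℓ : ℕ) (i : indexCube d m) : Func d m 0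
  | r (ℓ : ℕ) (i : indexCube d m) (j : Fin d → Bool) : Func d m 0

/-- Relation symbols: `cellRel ℓ` for the language `L̃_ℓ^d` and `domainRel ℓ` for the language
`L_{ℓ+1}`. -/
inductive Rel : ℕ → Type
  | cellRel (ℓ : ℕ) : Rel 1
  | domainRel (ℓ : ℕ) : Rel 1

/-- The signature of the structures `(𝓛_b^d; add_d, L̃_ℓ^d, L_ℓ, t^ℓ_i, r^ℓ_{ij})`. -/
def signature (d m : ℕ) : FirstOrder.Language.{0, 0} := ⟨Func d m, Rel⟩

/-- The structure `(𝓛_b^d; add_d, L̃_ℓ^d, L_ℓ, t^ℓ_i, r^ℓ_{ij})` of a hierarchical mesh. -/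
abbrev meshStructure (b : ℕ) [NeZero b] [Fact (2 ∣ b)] {d N : ℕ} (T : HierarchicalMesh d N) (m : ℕ) :
    (signature d m).Structure (Carrier b d) where
  funMap {_} f := match f with
    | Func.add => fun x => addWords b d (x 0) (x 1)
    | Func.t ℓ i => fun _ => encode b (gridVec b ℓ i)
    | Func.r ℓ i j => fun _ => encode b (gridVec b ℓ i + signVec b (ℓ + 1) j)
  RelMap {_} R := match R with
    | Rel.cellRel ℓ => fun x => (x 0 : List (Padded (Digits b) d)) ∈ cellLang b d ℓ
    | Rel.domainRel ℓ => fun x => (x 0 : List (Padded (Digits b) d)) ∈ T.domainLang b ℓ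

/-- The set of all `u ∈ 𝓛_b^d` for which the formula `φ(u)` is true in the structure of the mesh. -/
def definedLang (b : ℕ) [NeZero b] [Fact (2 ∣ b)] {d N m : ℕ} (T : HierarchicalMesh d N)
    (φ : (signature d m).Formula Unit) : Language (Padded (Digits b) d) :=
  letI := meshStructure b T m
  {w | ∃ h : w ∈ allWords b d, φ.Realize fun _ => (⟨w, h⟩ : Carrier b d)}

/-- The formula `u ∈ L̃_ℓ^d`. -/
def cellFormula (d m ℓ : ℕ) : (signature d m).Formula Unit :=
  FirstOrder.Language.Relations.formula₁ (L := signature d m) (Rel.cellRel ℓ)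
    (FirstOrder.Language.Term.var ())

/-- The formula `add_d(u, c) ∈ L_{ℓ+1}` for a constant symbol `c`. -/
def addMemFormula (d m : ℕ) (c : (signature d m).Constants) (ℓ : ℕ) :
    (signature d m).Formula Unit :=
  FirstOrder.Language.Relations.formula₁ (L := signature d m) (Rel.domainRel ℓ)
    (FirstOrder.Language.Functions.apply₂ (L := signature d m) Func.add
      (FirstOrder.Language.Term.var ()) (FirstOrder.Language.Constants.term c))

/-- The formula `Ψ_ℓ = ⋁_{i ∈ I_m} ¬ (add_d(u, t^ℓ_i) ∈ L_{ℓ+1})`. -/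
def Psi (d m ℓ : ℕ) : (signature d m).Formula Unit :=
  FirstOrder.Language.Formula.iSup fun i : indexCube d m =>
    (addMemFormula d m (Func.t ℓ i) ℓ).not

/-- For `ℓ + 1` in place of `ℓ`: the formula `⋀_{i ∈ I_m} ⋁_{j} (add_d(u, r^ℓ_{ij}) ∈ L_ℓ)`. -/
def insideSucc (d m ℓ : ℕ) : (signature d m).Formula Unit :=
  FirstOrder.Language.Formula.iInf fun i : indexCube d m =>
    FirstOrder.Language.Formula.iSup fun j : Fin d → Bool =>
      addMemFormula d m (Func.r (ℓ + 1) i j) ℓ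

/-- The formulas `Θ_0 = (u ∈ L̃_0^d) ∧ Ψ_0` and, for `ℓ > 0`,
`Θ_ℓ = (u ∈ L̃_ℓ^d) ∧ Ψ_ℓ ∧ ⋀_{i ∈ I_m} ⋁_j (add_d(u, r^ℓ_{ij}) ∈ L_ℓ)`. -/
def Theta (d m : ℕ) : ℕ → (signature d m).Formula Unit
  | 0 => cellFormula d m 0 ⊓ Psi d m 0
  | ℓ + 1 => cellFormula d m (ℓ + 1) ⊓ (Psi d m (ℓ + 1) ⊓ insideSucc d m ℓ)

/-- The formulas `Γ_ℓ = (u ∈ L̃_ℓ^d) ∧ ⋀_{i ∈ I_m} ⋁_j (add_d(u, r^ℓ_{ij}) ∈ L_ℓ)` for `ℓ > 0`.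
For `ℓ = 0`, which matters only for the mesh with a single level, there is no domain `L_0` to test,
and `Γ_0` is `u ∈ L̃_0^d`. -/
def Gamma (d m : ℕ) : ℕ → (signature d m).Formula Unit
  | 0 => cellFormula d m 0
  | ℓ + 1 => cellFormula d m (ℓ + 1) ⊓ insideSucc d m ℓ

/-! ### Deterministic finite automata as finite data -/

/-- Finite descriptions of deterministic automata over the alphabet of `𝓛_b^d`: a number `n`, a list
of transitions `((state, symbol), state)`, and a list of accepting states. -/
abbrev DFACode (b d : ℕ) : Type :=
  ℕ × List ((ℕ × (Fin d → Option (Digits b))) × ℕ) × List ℕ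

/-- The automaton described by a code `(n, transitions, accepting)`: its states are `0, …, n`, the
initial one is `0`, the transition function is read from the list (first matching entry, target
modulo `n + 1`, and `0` where there is no entry). -/
def DFACode.toDFA {b d : ℕ} (C : DFACode b d) : DFA (Padded (Digits b) d) (Fin (C.1 + 1)) where
  step q a := Fin.ofNat (C.1 + 1) ((C.2.1.lookup ((q : ℕ), (a : Fin d → Option (Digits b)))).getD 0)
  start := 0
  accept := {q | (q : ℕ) ∈ C.2.2}

/-- The code describes an automaton that recognizes the language. -/
def DFACode.Recognizes {b d : ℕ} (C : DFACode b d) (L : Language (Padded (Digits b) d)) : Prop :=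
  (DFACode.toDFA C).accepts = L

end HMesh

end

namespace HMesh

/-! ### Digits of elements of `ℤ[1/b]` -/

/-! Kraft's condition is local. The open support of a B-spline of level `ℓ` is covered by the cells
of level `ℓ` in its box, so it lies in the interior of a domain exactly when all these cells lie in
the domain. Their offsets from the associated cell form `I_m`; this gives `Ψ_ℓ`. The language of
`Ω^ℓ` lists cells of the coarser level `ℓ - 1`. A cell of level `ℓ` lies in `Ω^ℓ` exactly when its
parent does, and the barycentre of the parent is reached by a step `±1/2^(ℓ+1)` in each coordinate,
with exactly one sign pattern giving a barycentre; this gives the disjunction over `r`. With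
numerators over `2^(ℓ+1)`, selection and formulas both become the predicate `Selected`
(`tensorBspline_mem_kraft_iff_selected`, `realize_Psi`, `realize_insideSucc`).

Regularity is obtained by a Myhill–Nerode argument, not by closure of automatic structures under
first-order definitions. `Selected` only asks which states two automata reach on finitely many
bounded translates of a numerator vector. Since `2 ∣ b`, all fractional digits are exhausted after
enough symbols, and the rest of the word spells the high parts of the numerators. A bounded
translation alters a high part by a carry in `{-1, 0, 1}`. Hence a finite datum (high parts cut off
at 2, parities, states reached, carries) suffices to splice the low digits of one vector onto the
high digits of another (`exists_replaceHigh`). The carries depend on digits still to come, so a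
prefix is classified by the set of all data compatible with it
(`append_mem_translateLang_of_prefixClass_eq`).

The number of classes has an explicit bound in terms of the sizes of the given automata. Words of
length up to its square represent all left quotients and tell them apart, so an automaton can be
assembled from a membership test (`codeOfWords_wordsUpTo_recognizes`). Membership is a bounded
search over numerators, and the whole construction is primitive recursive. Regularity follows by
applying it to any codes for the given regular languages. -/

theorem two_le_base (b : ℕ) [NeZero b] [h : Fact (2 ∣ b)] : 2 ≤ b :=
  Nat.le_of_dvd (Nat.pos_of_ne_zero (NeZero.ne b)) h.out

theorem exists_abs_mul_pow_eq_natCast {b : ℕ} [NeZero b] (z : zinv b) :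
    ∃ K : ℕ, ∀ k, K ≤ k → ∃ n : ℕ, |(z : ℚ)| * (b : ℚ) ^ k = n := by
  obtain ⟨s, K, hz⟩ := z.2
  have hb : (0 : ℚ) < b := by exact_mod_cast Nat.pos_of_ne_zero (NeZero.ne b)
  refine ⟨K, fun k hk => ⟨s.natAbs * b ^ (k - K), ?_⟩⟩
  obtain ⟨e, rfl⟩ := Nat.exists_eq_add_of_le hk
  rw [hz, abs_div, abs_of_pos (pow_pos hb K), pow_add]
  push_cast
  rw [Nat.cast_natAbs]
  simp only [add_tsub_cancel_left]
  push_cast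
  field_simp

theorem eq_of_digits_eq {b : ℕ} (hb : 2 ≤ b) {n n' : ℕ}
    (h : ∀ i, n / b ^ i % b = n' / b ^ i % b) : n = n' := by
  induction n using Nat.strong_induction_on generalizing n' with
  | _ n ih =>
    have h0 : n % b = n' % b := by simpa using h 0
    have hrec : n ≠ 0 → n / b = n' / b := fun hn => by
      refine ih _ (Nat.div_lt_self (Nat.pos_of_ne_zero hn) hb) fun i => ?_
      have := h (i + 1)
      rwa [pow_succ', ← Nat.div_div_eq_div_mul, ← Nat.div_div_eq_div_mul] at this
    by_cases hn : n = 0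
    · subst hn
      by_contra hne
      have hz : ∀ i, n' / b ^ i % b = 0 := fun i => by simpa using (h i).symm
      -- All digits of `n'` vanish, so every power of `b` divides it; the power `b ^ n' > n'` then
      -- leaves only `n' = 0`.
      have hall : ∀ i, b ^ i ∣ n' := by
        intro i
        induction i with
        | zero => simp
        | succ i ih' =>
          rw [pow_succ]
          exact (Nat.dvd_div_iff_mul_dvd ih').1 (Nat.dvd_of_mod_eq_zero (hz i))
      have := Nat.le_of_dvd (Nat.pos_of_ne_zero (Ne.symm hne)) (hall n')
      exact absurd this (not_le.2 (Nat.lt_pow_self hb))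
    · have := hrec hn
      rw [← Nat.div_add_mod n b, ← Nat.div_add_mod n' b, h0, this]

theorem floor_mul_pow_succ_div {b : ℕ} (hb : 0 < b) (q : ℚ) (n : ℕ) :
    ⌊q * (b : ℚ) ^ (n + 1)⌋₊ / b = ⌊q * (b : ℚ) ^ n⌋₊ := by
  have hb' : (b : ℚ) ≠ 0 := by exact_mod_cast hb.ne'
  rw [← Nat.floor_div_natCast, pow_succ]
  congr 1
  field_simp

theorem ofNat_inj_mod {b : ℕ} [NeZero b] {m n : ℕ} :
    Fin.ofNat b m = Fin.ofNat b n ↔ m % b = n % b := by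
  simp [Fin.ext_iff]

theorem ofNat_eq_zero_iff {b : ℕ} [NeZero b] {m : ℕ} : Fin.ofNat b m = 0 ↔ m % b = 0 := by
  simp [Fin.ext_iff]

/-- The first components determine the integer part, and each further fractional digit extends the
truncation `⌊|z| b^n⌋` to `n + 1`. For large `n` the truncations are exact because expansions in
`ℤ[1/b]` terminate. -/
theorem abs_eq_of_digitPair_eq {b : ℕ} [NeZero b] (hb : 2 ≤ b) {z z' : zinv b}
    (h : ∀ i, digitPair b z i = digitPair b z' i) : |(z : ℚ)| = |(z' : ℚ)| := by
  have hfl : ∀ n, ⌊|(z : ℚ)| * (b : ℚ) ^ n⌋₊ = ⌊|(z' : ℚ)| * (b : ℚ) ^ n⌋₊ := by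
    intro n
    induction n with
    | zero =>
      simp only [pow_zero, mul_one]
      refine eq_of_digits_eq hb fun i => ?_
      exact ofNat_inj_mod.1 (congrArg Prod.fst (h i))
    | succ n ih =>
      have h2 := ofNat_inj_mod.1 (congrArg Prod.snd (h n))
      rw [← Nat.div_add_mod ⌊|(z : ℚ)| * (b : ℚ) ^ (n + 1)⌋₊ b,
        ← Nat.div_add_mod ⌊|(z' : ℚ)| * (b : ℚ) ^ (n + 1)⌋₊ b, h2,
        floor_mul_pow_succ_div (by omega), floor_mul_pow_succ_div (by omega), ih]
  obtain ⟨K, hK⟩ := exists_abs_mul_pow_eq_natCast z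
  obtain ⟨K', hK'⟩ := exists_abs_mul_pow_eq_natCast z'
  obtain ⟨n, hn⟩ := hK (max K K') (le_max_left _ _)
  obtain ⟨n', hn'⟩ := hK' (max K K') (le_max_right _ _)
  have := hfl (max K K')
  rw [hn, hn', Nat.floor_natCast, Nat.floor_natCast] at this
  have hb0 : (b : ℚ) ^ (max K K') ≠ 0 := pow_ne_zero _ (by exact_mod_cast NeZero.ne b)
  refine mul_right_cancel₀ hb0 ?_
  rw [hn, hn', this]

/-- The integral digits vanish from position `i` on when `|z| < b^i`, the fractional ones when `|z|
b^i` is an integer. This replaces the minimality in `numDigits` by arithmetic conditions at a single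
position. -/
theorem digitPair_eq_zero_iff {b : ℕ} [NeZero b] (hb : 2 ≤ b) (z : zinv b) (i : ℕ) :
    (∀ i', i ≤ i' → digitPair b z i' = (0, 0)) ↔
      |(z : ℚ)| < (b : ℚ) ^ i ∧ ∃ n : ℕ, |(z : ℚ)| * (b : ℚ) ^ i = n := by
  have hb0 : (0 : ℚ) < b := by exact_mod_cast (by omega : 0 < b)
  constructor
  · intro h
    constructor
    · have : ⌊|(z : ℚ)|⌋₊ / b ^ i = 0 := by
        refine eq_of_digits_eq hb fun e => ?_
        have := ofNat_eq_zero_iff.1 (congrArg Prod.fst (h (i + e) (by omega)))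
        rw [Nat.div_div_eq_div_mul, ← pow_add, this]
        simp
      rw [Nat.div_eq_zero_iff] at this
      have h1 := this.resolve_left (by positivity)
      rw [Nat.floor_lt (abs_nonneg _)] at h1
      exact_mod_cast h1
    -- With zero digits appended, each truncation is exactly `b` times the preceding one. At an
    -- exponent where the truncation is exact, dividing back by `b ^ K` shows that it was exact at
    -- `i`.
    · have hfl : ∀ e, ⌊|(z : ℚ)| * (b : ℚ) ^ (i + e)⌋₊ = b ^ e * ⌊|(z : ℚ)| * (b : ℚ) ^ i⌋₊ := by
        intro e
        induction e with
        | zero => simp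
        | succ e ih =>
          have h2 := ofNat_eq_zero_iff.1 (congrArg Prod.snd (h (i + e) (by omega)))
          have h3 := floor_mul_pow_succ_div (by omega : 0 < b) |(z : ℚ)| (i + e)
          rw [← Nat.div_add_mod ⌊|(z : ℚ)| * (b : ℚ) ^ (i + (e + 1))⌋₊ b]
          rw [← add_assoc, h2, h3, ih, pow_succ]
          ring
      obtain ⟨K, hK⟩ := exists_abs_mul_pow_eq_natCast z
      obtain ⟨n, hn⟩ := hK (i + K) (by omega)
      have h4 := hfl K
      rw [hn, Nat.floor_natCast] at h4
      refine ⟨⌊|(z : ℚ)| * (b : ℚ) ^ i⌋₊, ?_⟩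
      have h5 : (b : ℚ) ^ K ≠ 0 := by positivity
      refine mul_left_cancel₀ h5 ?_
      have h6 : (n : ℚ) = (b : ℚ) ^ K * (⌊|(z : ℚ)| * (b : ℚ) ^ i⌋₊ : ℚ) := by exact_mod_cast h4
      rw [← h6, ← hn, pow_add]
      ring
  · rintro ⟨hlt, n, hn⟩ i' hi'
    obtain ⟨e, rfl⟩ := Nat.exists_eq_add_of_le hi'
    have h1 : ⌊|(z : ℚ)|⌋₊ < b ^ (i + e) := by
      rw [Nat.floor_lt (abs_nonneg _)]
      push_cast
      exact hlt.trans_le (pow_le_pow_right₀ (by exact_mod_cast (by omega : 1 ≤ b)) (by omega))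
    have h2 : |(z : ℚ)| * (b : ℚ) ^ (i + e + 1) = ((n * b ^ e * b : ℕ) : ℚ) := by
      push_cast
      rw [← hn]
      ring
    refine Prod.ext ?_ ?_
    · exact ofNat_eq_zero_iff.2 (by rw [Nat.div_eq_of_lt h1]; simp)
    · refine ofNat_eq_zero_iff.2 ?_
      rw [h2, Nat.floor_natCast]
      simp

theorem lt_numDigits_iff {b : ℕ} [NeZero b] (hb : 2 ≤ b) (z : zinv b) (i : ℕ) :
    i < numDigits b z ↔
      ¬(|(z : ℚ)| < (b : ℚ) ^ i ∧ ∃ n : ℕ, |(z : ℚ)| * (b : ℚ) ^ i = n) := by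
  rw [← digitPair_eq_zero_iff hb]
  -- Without this, `sInf` could be the default value `0` of the empty set.
  have hne : {k | ∀ i, k ≤ i → digitPair b z i = (0, 0)}.Nonempty := by
    obtain ⟨K, hK⟩ := exists_abs_mul_pow_eq_natCast z
    obtain ⟨K', hK'⟩ := exists_nat_gt |(z : ℚ)|
    refine ⟨max K K', (digitPair_eq_zero_iff hb z _).2 ⟨hK'.trans_le ?_, hK _ (le_max_left _ _)⟩⟩
    have : K' ≤ b ^ max K K' := (le_max_right K K').trans (Nat.lt_pow_self hb).le
    exact_mod_cast this
  constructor
  · intro h h'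
    have h'' : i ∈ {k | ∀ i, k ≤ i → digitPair b z i = (0, 0)} := h'
    exact absurd (Nat.sInf_le h'') (not_le.2 h)
  · intro h
    by_contra h'
    exact h fun i' hi' => Nat.sInf_mem hne i' ((not_lt.1 h').trans hi')

theorem word_getElem?_zero {b : ℕ} [NeZero b] (z : zinv b) : (word b z)[0]? =
    some (if (z : ℚ) < 0 then (Fin.ofNat b 1, Fin.ofNat b 1) else (0, 0)) := by
  simp [word]

theorem word_getElem?_succ {b : ℕ} [NeZero b] (z : zinv b) (i : ℕ) : (word b z)[i + 1]? =
    if i < numDigits b z then some (digitPair b z i) else none := by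
  simp only [word, List.getElem?_cons_succ, List.getElem?_ofFn]
  split_ifs <;> rfl

theorem word_injective {b : ℕ} [NeZero b] (hb : 2 ≤ b) : Function.Injective (word b) := by
  intro z z' h
  have hsgn : (z : ℚ) < 0 ↔ (z' : ℚ) < 0 := by
    have h0 := congrArg (fun l => l[0]?) h
    simp only [word_getElem?_zero, Option.some.injEq] at h0
    have h10 : Fin.ofNat b 1 ≠ 0 := by
      rw [Ne, ofNat_eq_zero_iff, Nat.mod_eq_of_lt hb]
      simp
    split_ifs at h0 with h1 h2 h2
    · simp [h1, h2]
    · exact absurd (congrArg Prod.fst h0) h10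
    · exact absurd (congrArg Prod.fst h0).symm h10
    · simp [h1, h2]
  have hzero : ∀ (y : zinv b) i, ¬ i < numDigits b y → digitPair b y i = (0, 0) := by
    intro y i hi
    rw [lt_numDigits_iff hb, not_not, ← digitPair_eq_zero_iff hb] at hi
    exact hi i le_rfl
  have habs : |(z : ℚ)| = |(z' : ℚ)| := by
    refine abs_eq_of_digitPair_eq hb fun i => ?_
    have hi := congrArg (fun l => l[i + 1]?) h
    simp only [word_getElem?_succ] at hi
    split_ifs at hi with h1 h2 h2
    · simpa using hi
    · rw [hzero z i h1, hzero z' i h2]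
  refine Subtype.ext ?_
  by_cases hz : (z : ℚ) < 0
  · have hz' := hsgn.1 hz
    rw [abs_of_neg hz, abs_of_neg hz'] at habs
    linarith
  · have hz' := fun h => hz (hsgn.2 h)
    rwa [abs_of_nonneg (not_lt.1 hz), abs_of_nonneg (not_lt.1 hz')] at habs

/-! ### Convolutions as streams of symbols -/

/-- The symbol at position `p` of a word over the padded alphabet, and `(⋄, …, ⋄)` beyond the end
of the word. -/
def symbolAt {σ : Type} {k : ℕ} (w : List (Padded σ k)) (p : ℕ) : Fin k → Option σ :=
  (w.map Subtype.val).getD p fun _ => none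

theorem symbolAt_of_lt {σ : Type} {k : ℕ} {w : List (Padded σ k)} {p : ℕ} (h : p < w.length) :
    symbolAt w p = (w[p]).1 := by
  simp [symbolAt, h]

theorem symbolAt_eq_none_iff {σ : Type} {k : ℕ} {w : List (Padded σ k)} {p : ℕ} :
    symbolAt w p = (fun _ => none) ↔ w.length ≤ p := by
  constructor
  · intro h
    by_contra hp
    rw [symbolAt_of_lt (not_le.1 hp)] at h
    obtain ⟨j, hj⟩ := (w[p]'(not_le.1 hp)).2
    exact hj (congrFun h j)
  · intro h
    simp [symbolAt, h]

/-- No letter of the padded alphabet is `(⋄, …, ⋄)`, so the padded stream also reveals where the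
word ends. -/
theorem eq_of_symbolAt_eq {σ : Type} {k : ℕ} {w w' : List (Padded σ k)}
    (h : ∀ p, symbolAt w p = symbolAt w' p) : w = w' := by
  have hlen : ∀ p, w.length ≤ p ↔ w'.length ≤ p := fun p => by
    rw [← symbolAt_eq_none_iff, h, symbolAt_eq_none_iff]
  refine List.ext_getElem (le_antisymm ((hlen _).2 le_rfl) ((hlen _).1 le_rfl)) fun p h1 h2 => ?_
  refine Subtype.ext ?_
  rw [← symbolAt_of_lt h1, ← symbolAt_of_lt h2, h]

theorem symbolAt_convolution {σ : Type} {k : ℕ} (w : Fin k → List σ) (p : ℕ) :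
    symbolAt (convolution w) p = fun j => (w j)[p]? := by
  by_cases hp : p < Finset.univ.sup fun j => (w j).length
  · rw [symbolAt_of_lt (by simpa [convolution] using hp)]
    simp [convolution]
  · rw [symbolAt_eq_none_iff.2 (by simpa [convolution] using hp)]
    funext j
    symm
    rw [List.getElem?_eq_none_iff]
    exact (Finset.le_sup (f := fun j => (w j).length) (Finset.mem_univ j)).trans (not_lt.1 hp)

theorem wordVec_injective {b d : ℕ} [NeZero b] (hb : 2 ≤ b) :
    Function.Injective (wordVec b (d := d)) := by
  intro z z' h
  funext j
  refine word_injective hb (List.ext_getElem? fun p => ?_)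
  have := congrArg (fun w => symbolAt w p j) h
  simpa only [wordVec, symbolAt_convolution] using this

theorem decode_encode {b d : ℕ} [NeZero b] (hb : 2 ≤ b) (z : Fin d → zinv b) :
    decode b d (encode b z) = z :=
  wordVec_injective hb (encode b z).2.choose_spec

/-! ### The words of grid vectors -/

/-- The symbol at position `p` of the word of `± A / 2 ^ L`, the sign being `-` if `s` is `true`. -/
def digitSymbol (b : ℕ) [NeZero b] (L : ℕ) (s : Bool) (A : ℕ) : ℕ → Option (Digits b)
  | 0 => some (if s then (Fin.ofNat b 1, Fin.ofNat b 1) else (0, 0))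
  | i + 1 =>
    if A < b ^ i * 2 ^ L ∧ A * b ^ i % 2 ^ L = 0 then none
    else some (Fin.ofNat b (A / 2 ^ L / b ^ i), Fin.ofNat b (A * b ^ (i + 1) / 2 ^ L))

/-- The symbol at position `p` of the word of the vector `k / 2 ^ L`. -/
def gridSymbol (b : ℕ) [NeZero b] {d : ℕ} (L : ℕ) (k : Fin d → ℤ) (p : ℕ) :
    Fin d → Option (Digits b) :=
  fun j => digitSymbol b L (decide (k j < 0)) (k j).natAbs p

/-- Floors of rationals become divisions of natural numbers. The fraction `k / 2 ^ L` need not be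
reduced, so vectors of different levels can share one denominator, and the symbols can later be
computed by a primitive recursive function. -/
theorem word_getElem?_eq_digitSymbol {b : ℕ} [NeZero b] (hb : 2 ≤ b) (L : ℕ) (k : ℤ) (z : zinv b)
    (hz : (z : ℚ) = k / 2 ^ L) (p : ℕ) :
    (word b z)[p]? = digitSymbol b L (decide (k < 0)) k.natAbs p := by
  have h2 : (0 : ℚ) < 2 ^ L := by positivity
  have habs : |(z : ℚ)| = (k.natAbs : ℚ) / ((2 ^ L : ℕ) : ℚ) := by
    rw [hz, abs_div, abs_of_pos h2, Nat.cast_natAbs]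
    push_cast
    rfl
  cases p with
  | zero =>
    rw [word_getElem?_zero, digitSymbol]
    have : (z : ℚ) < 0 ↔ k < 0 := by
      rw [hz, div_lt_iff₀ h2]
      simp
    simp [this]
  | succ i =>
    rw [word_getElem?_succ, digitSymbol]
    have hlt : |(z : ℚ)| < (b : ℚ) ^ i ↔ k.natAbs < b ^ i * 2 ^ L := by
      rw [habs, div_lt_iff₀ (by positivity)]
      exact_mod_cast Iff.rfl
    have hint : (∃ n : ℕ, |(z : ℚ)| * (b : ℚ) ^ i = n) ↔ k.natAbs * b ^ i % 2 ^ L = 0 := by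
      rw [← Nat.dvd_iff_mod_eq_zero, habs]
      constructor
      · rintro ⟨n, hn⟩
        refine ⟨n, ?_⟩
        have h3 : ((2 ^ L : ℕ) : ℚ) ≠ 0 := by positivity
        field_simp at hn
        exact_mod_cast hn
      · rintro ⟨n, hn⟩
        refine ⟨n, ?_⟩
        have h3 : ((2 ^ L : ℕ) : ℚ) ≠ 0 := by positivity
        field_simp
        exact_mod_cast hn
    have hdig : digitPair b z i =
        (Fin.ofNat b (k.natAbs / 2 ^ L / b ^ i), Fin.ofNat b (k.natAbs * b ^ (i + 1) / 2 ^ L)) := by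
      rw [digitPair, habs, Nat.floor_div_eq_div]
      congr 2
      rw [div_mul_eq_mul_div]
      exact_mod_cast Nat.floor_div_eq_div (K := ℚ) (k.natAbs * b ^ (i + 1)) (2 ^ L)
    rw [hdig]
    simp only [lt_numDigits_iff hb, hlt, hint, ite_not]

theorem symbolAt_wordVec_gridVec {b d : ℕ} [NeZero b] [Fact (2 ∣ b)] (L : ℕ) (k : Fin d → ℤ)
    (p : ℕ) : symbolAt (wordVec b (gridVec b L k)) p = gridSymbol b L k p := by
  rw [wordVec, symbolAt_convolution]
  funext j
  exact word_getElem?_eq_digitSymbol (two_le_base b) L (k j) _ rfl p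

theorem eq_wordVec_gridVec_iff {b d : ℕ} [NeZero b] [Fact (2 ∣ b)] {L : ℕ} {k : Fin d → ℤ}
    {w : List (Padded (Digits b) d)} :
    w = wordVec b (gridVec b L k) ↔ ∀ p, symbolAt w p = gridSymbol b L k p :=
  ⟨fun h p => by rw [h, symbolAt_wordVec_gridVec],
    fun h => eq_of_symbolAt_eq fun p => by rw [h, symbolAt_wordVec_gridVec]⟩

theorem gridVec_injective {b d : ℕ} [NeZero b] [Fact (2 ∣ b)] (L : ℕ) :
    Function.Injective (gridVec b (d := d) L) := by
  intro k k' h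
  funext j
  have := congrArg Subtype.val (congrFun h j)
  simp only [gridVec] at this
  have h2 : (2 : ℚ) ^ L ≠ 0 := by positivity
  field_simp at this
  exact_mod_cast this

theorem gridVec_add {b d : ℕ} [NeZero b] [Fact (2 ∣ b)] (L : ℕ) (k k' : Fin d → ℤ) :
    gridVec b L (k + k') = gridVec b L k + gridVec b L k' := by
  funext j
  refine Subtype.ext ?_
  simp [gridVec, add_div]

theorem gridVec_succ {b d : ℕ} [NeZero b] [Fact (2 ∣ b)] (L : ℕ) (k : Fin d → ℤ) :
    gridVec b (L + 1) (fun j => 2 * k j) = gridVec b L k := by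
  funext j
  refine Subtype.ext ?_
  simp only [gridVec]
  push_cast
  field_simp
  ring

end HMesh

namespace HMesh

/-! ### Supports of B-splines -/

theorem knot_lt_knot {ℓ : ℕ} {i j : ℤ} : knot ℓ i < knot ℓ j ↔ i < j := by
  unfold knot
  rw [div_lt_div_iff_of_pos_right (by positivity)]
  exact_mod_cast Iff.rfl

theorem knot_le_knot {ℓ : ℕ} {i j : ℤ} : knot ℓ i ≤ knot ℓ j ↔ i ≤ j := by
  rw [← not_lt, knot_lt_knot, not_lt]

theorem bspline_eq_zero {ℓ m : ℕ} {i : ℤ} {x : ℝ}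
    (hx : x ∉ Ico (knot ℓ i) (knot ℓ (i + (m + 1)))) : bspline ℓ m i x = 0 := by
  induction m generalizing i with
  | zero =>
    rw [bspline, indicator_of_notMem]
    simpa using hx
  | succ j ih =>
    have h1 : bspline ℓ j i x = 0 := ih fun h => hx
      ⟨h.1, h.2.trans_le (knot_le_knot.2 (by push_cast; omega))⟩
    have h2 : bspline ℓ j (i + 1) x = 0 := ih fun h => hx
      ⟨(knot_le_knot.2 (by omega)).trans h.1,
        h.2.trans_le (knot_le_knot.2 (by push_cast; omega))⟩
    rw [bspline, h1, h2]
    simp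

theorem bspline_nonneg (ℓ m : ℕ) (i : ℤ) (x : ℝ) : 0 ≤ bspline ℓ m i x := by
  induction m generalizing i with
  | zero => exact indicator_nonneg (fun _ _ => zero_le_one) x
  | succ j ih =>
    rw [bspline]
    refine add_nonneg ?_ ?_
    · by_cases hx : x ∈ Ico (knot ℓ i) (knot ℓ (i + (j + 1)))
      · exact mul_nonneg (div_nonneg (sub_nonneg.2 hx.1)
          (sub_nonneg.2 (hx.1.trans hx.2.le))) (ih i)
      · rw [bspline_eq_zero hx, mul_zero]
    · by_cases hx : x ∈ Ico (knot ℓ (i + 1)) (knot ℓ (i + 1 + (j + 1)))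
      · rw [add_right_comm i 1] at hx
        exact mul_nonneg (div_nonneg (sub_nonneg.2 hx.2.le)
          (sub_nonneg.2 (hx.1.trans hx.2.le))) (ih _)
      · rw [bspline_eq_zero hx, mul_zero]

/-- Both summands of the recursion are nonnegative, and at each point one of them is positive: the
first to the left of the last knot of its spline, the second from there on. The left endpoint is
excluded for positive degree because the spline vanishes there. -/
theorem bspline_pos {ℓ m : ℕ} {i : ℤ} {x : ℝ}
    (hx : x ∈ Ico (knot ℓ i) (knot ℓ (i + (m + 1)))) (hx' : m = 0 ∨ knot ℓ i < x) :
    0 < bspline ℓ m i x := by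
  induction m generalizing i with
  | zero =>
    rw [bspline, indicator_of_mem (by simpa using hx)]
    exact one_pos
  | succ j ih =>
    have hx'' : knot ℓ i < x := by simpa using hx'
    rw [bspline]
    have hn1 := bspline_nonneg ℓ j i x
    have hn2 := bspline_nonneg ℓ j (i + 1) x
    have e1 : i + (j + 1) + 1 = i + (((j + 1 : ℕ) : ℤ) + 1) := by push_cast; ring
    have hd1 : 0 < knot ℓ (i + (j + 1)) - knot ℓ i := sub_pos.2 (knot_lt_knot.2 (by omega))
    have hd2 : 0 < knot ℓ (i + (j + 1) + 1) - knot ℓ (i + 1) :=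
      sub_pos.2 (knot_lt_knot.2 (by omega))
    have hp1 : 0 < x - knot ℓ i := sub_pos.2 hx''
    have hp2 : 0 < knot ℓ (i + (j + 1) + 1) - x := by rw [e1]; exact sub_pos.2 hx.2
    rcases lt_or_ge x (knot ℓ (i + (j + 1))) with h | h
    · have := ih ⟨hx''.le, h⟩ (Or.inr hx'')
      positivity
    · have h1 : knot ℓ (i + 1) ≤ x := (knot_le_knot.2 (by omega)).trans h
      have := ih (i := i + 1) ⟨h1, by
        have := hx.2
        rwa [← e1, add_right_comm i _ 1] at this⟩ (by
          rcases Nat.eq_zero_or_pos j with hj | hj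
          · exact Or.inl hj
          · exact Or.inr ((knot_lt_knot.2 (by omega)).trans_le h))
      positivity

/-- The nonzero set contains the open box and is contained in the half-open box, whose interior is
the open box. -/
theorem support_tensorBspline {d : ℕ} (ℓ m : ℕ) (i : Fin d → ℤ) :
    support (tensorBspline ℓ m i) =
      univ.pi fun j => Ioo (knot ℓ (i j)) (knot ℓ (i j + (m + 1))) := by
  refine Subset.antisymm ?_ (interior_maximal (fun x hx => ?_)
    (isOpen_set_pi finite_univ fun j _ => isOpen_Ioo))
  · have : {x : Fin d → ℝ | tensorBspline ℓ m i x ≠ 0} ⊆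
        univ.pi fun j => Ico (knot ℓ (i j)) (knot ℓ (i j + (m + 1))) := by
      intro x hx j _
      by_contra h
      exact hx (Finset.prod_eq_zero (Finset.mem_univ j) (bspline_eq_zero h))
    refine (interior_mono this).trans ?_
    rw [interior_pi_set finite_univ]
    simp only [interior_Ico]
    exact Subset.rfl
  · exact (Finset.prod_pos fun j _ =>
      bspline_pos ⟨(hx j trivial).1.le, (hx j trivial).2⟩ (Or.inr (hx j trivial).1)).ne'

/-! ### Cells and their centres -/

/-- The centre of the cell of level `ℓ` and index `c`. -/
noncomputable def centre {d : ℕ} (ℓ : ℕ) (c : Fin d → ℤ) : Fin d → ℝ := fun j => knot (ℓ + 1) (2 * c j + 1)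

theorem knot_add (ℓ e : ℕ) (i : ℤ) : knot (ℓ + e) (2 ^ e * i) = knot ℓ i := by
  unfold knot
  push_cast
  rw [pow_add]
  field_simp

/-- Over the knots of level `ℓ + e + 1` a centre has odd coordinates and the faces of a level-`ℓ`
cell have even ones. So a centre never lies on a face, and belonging to the closed coarse cell
forces its whole cell to fit inside. -/
theorem centre_mem_cell_iff {d : ℕ} {ℓ e : ℕ} {c c' : Fin d → ℤ} :
    centre (ℓ + e) c ∈ cell ℓ c' ↔ ∀ j, 2 ^ e * c' j ≤ c j ∧ c j + 1 ≤ 2 ^ e * (c' j + 1) := by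
  have key : ∀ j, (knot ℓ (c' j) ≤ centre (ℓ + e) c j ∧ centre (ℓ + e) c j ≤ knot ℓ (c' j + 1)) ↔
      (2 ^ e * c' j ≤ c j ∧ c j + 1 ≤ 2 ^ e * (c' j + 1)) := by
    intro j
    rw [centre, ← knot_add ℓ (e + 1), ← knot_add ℓ (e + 1) (c' j + 1), ← add_assoc,
      knot_le_knot, knot_le_knot, pow_succ']
    generalize h1 : (2 : ℤ) ^ e * c' j = u
    generalize h2 : (2 : ℤ) ^ e * (c' j + 1) = v
    rw [mul_assoc, mul_assoc, h1, h2]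
    omega
  simp only [cell, mem_Icc, Pi.le_def, ← forall_and]
  exact forall_congr' key

theorem cell_subset_cell {d : ℕ} {ℓ e : ℕ} {c c' : Fin d → ℤ}
    (h : centre (ℓ + e) c ∈ cell ℓ c') : cell (ℓ + e) c ⊆ cell ℓ c' := by
  rw [centre_mem_cell_iff] at h
  refine Icc_subset_Icc (fun j => ?_) (fun j => ?_)
  · rw [← knot_add ℓ e, knot_le_knot]
    exact (h j).1
  · rw [← knot_add ℓ e, knot_le_knot]
    exact (h j).2

theorem centre_mem_cell {d : ℕ} (ℓ : ℕ) (c : Fin d → ℤ) : centre ℓ c ∈ cell ℓ c := by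
  have := @centre_mem_cell_iff d ℓ 0 c c
  exact this.2 fun j => by simp

theorem centre_mem_support {d : ℕ} {ℓ m : ℕ} {i c : Fin d → ℤ}
    (h : ∀ j, i j ≤ c j ∧ c j ≤ i j + m) : centre ℓ c ∈ support (tensorBspline ℓ m i) := by
  rw [support_tensorBspline]
  intro j _
  have e1 : ∀ k : ℤ, knot ℓ k = knot (ℓ + 1) (2 * k) := fun k => by
    rw [← knot_add ℓ 1]; simp
  dsimp only
  rw [centre, e1, e1, mem_Ioo, knot_lt_knot, knot_lt_knot]
  have := h j
  omega

theorem exists_cell_of_mem_support {d : ℕ} {ℓ m : ℕ} {i : Fin d → ℤ} {x : Fin d → ℝ}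
    (hx : x ∈ support (tensorBspline ℓ m i)) :
    ∃ c : Fin d → ℤ, (∀ j, i j ≤ c j ∧ c j ≤ i j + m) ∧ x ∈ cell ℓ c := by
  rw [support_tensorBspline] at hx
  have h2 : (0 : ℝ) < 2 ^ ℓ := by positivity
  refine ⟨fun j => ⌊x j * 2 ^ ℓ⌋, fun j => ?_, fun j => ?_, fun j => ?_⟩
  · obtain ⟨h3, h4⟩ := hx j trivial
    unfold knot at h3 h4
    rw [div_lt_iff₀ h2] at h3
    rw [lt_div_iff₀ h2] at h4
    refine ⟨Int.le_floor.2 h3.le, ?_⟩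
    have : ⌊x j * 2 ^ ℓ⌋ < i j + (m + 1) := Int.floor_lt.2 h4
    dsimp only
    omega
  · unfold knot
    dsimp only
    rw [div_le_iff₀ h2]
    exact Int.floor_le _
  · unfold knot
    dsimp only
    rw [le_div_iff₀ h2]
    push_cast
    exact (Int.lt_floor_add_one _).le

end HMesh

/-! ### Kraft's selection in terms of cells -/

namespace HierarchicalMesh

open HMesh

variable {d N : ℕ} (T : HierarchicalMesh d N)

theorem pos_levels {d N : ℕ} (T : HierarchicalMesh d N) : 0 < N := by
  by_contra h
  have h0 := T.top 0 (by omega)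
  rw [T.zero] at h0
  exact (univ_nonempty (α := Fin d → ℝ)).ne_empty h0

/-- The centre lies in one of the coarse cells that make up the domain, and that coarse cell then
contains the whole finer cell. -/
theorem cell_subset_iff_centre_mem {ℓ e : ℕ} (hℓ : ℓ + 1 < N) (c : Fin d → ℤ) :
    cell (ℓ + e) c ⊆ T.Ω (ℓ + 1) ↔ centre (ℓ + e) c ∈ T.Ω (ℓ + 1) := by
  refine ⟨fun h => h (centre_mem_cell _ c), fun h => ?_⟩
  obtain ⟨M, hM, hΩ⟩ := T.composed ℓ hℓ
  rw [hΩ] at h ⊢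
  obtain ⟨C, hC, hc⟩ := h
  obtain ⟨c', rfl⟩ := hM hC
  exact (cell_subset_cell hc).trans (subset_sUnion_of_mem hC)

/-- The centres of the cells of the box lie in the support, and these cells cover the support. As
the support is open, covering it by cells of the domain already puts it into the interior. -/
theorem support_subset_interior_iff {ℓ e m : ℕ} (hℓ : ℓ + 1 < N) (i : Fin d → ℤ) :
    support (tensorBspline (ℓ + e) m i) ⊆ interior (T.Ω (ℓ + 1)) ↔
      ∀ c : Fin d → ℤ, (∀ j, i j ≤ c j ∧ c j ≤ i j + m) → cell (ℓ + e) c ⊆ T.Ω (ℓ + 1) := by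
  constructor
  · intro h c hc
    rw [cell_subset_iff_centre_mem T hℓ]
    exact interior_subset (h (centre_mem_support hc))
  · intro h
    refine interior_maximal (fun x hx => ?_) isOpen_interior
    obtain ⟨c, hc, hxc⟩ := exists_cell_of_mem_support hx
    exact h c hc hxc

theorem support_inter_prevRing (β : (Fin d → ℝ) → ℝ) (ℓ : ℕ) :
    support β ∩ T.prevRing ℓ = ∅ ↔ support β ⊆ interior (T.Ω ℓ) := by
  rw [prevRing, ← compl_eq_univ_sdiff, ← disjoint_iff_inter_eq_empty,
    disjoint_compl_right_iff_subset]

theorem support_nonempty (ℓ m : ℕ) (i : Fin d → ℤ) :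
    (support (tensorBspline ℓ m i)).Nonempty :=
  ⟨_, centre_mem_support (c := i) fun j => by omega⟩

/-- The two guards are the extreme levels: for `ℓ + 1 = N` the next domain is empty, so a nonempty
support meets its complement; for `ℓ = 0` the domain is the whole space. -/
theorem tensorBspline_mem_kraft_iff {ℓ m : ℕ} (hℓ : ℓ < N) (i : Fin d → ℤ) :
    tensorBspline ℓ m i ∈ T.kraft m ℓ ↔
      (ℓ + 1 < N → ∃ c : Fin d → ℤ, (∀ j, i j ≤ c j ∧ c j ≤ i j + m) ∧
        ¬ cell ℓ c ⊆ T.Ω (ℓ + 1)) ∧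
      (∀ ℓ', ℓ = ℓ' + 1 → ∀ c : Fin d → ℤ, (∀ j, i j ≤ c j ∧ c j ≤ i j + m) →
        cell ℓ c ⊆ T.Ω ℓ) := by
  have h1 : support (tensorBspline ℓ m i) ∩ T.prevRing ℓ = ∅ ↔
      ∀ ℓ', ℓ = ℓ' + 1 → ∀ c : Fin d → ℤ, (∀ j, i j ≤ c j ∧ c j ≤ i j + m) →
        cell ℓ c ⊆ T.Ω ℓ := by
    rw [support_inter_prevRing]
    cases ℓ with
    | zero => simp [T.zero]
    | succ ℓ' =>
      rw [support_subset_interior_iff T (e := 1) hℓ]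
      exact ⟨fun h _ _ => h, fun h => h ℓ' rfl⟩
  have h2 : support (tensorBspline ℓ m i) ∩ T.prevRing (ℓ + 1) ≠ ∅ ↔
      (ℓ + 1 < N → ∃ c : Fin d → ℤ, (∀ j, i j ≤ c j ∧ c j ≤ i j + m) ∧
        ¬ cell ℓ c ⊆ T.Ω (ℓ + 1)) := by
    rw [Ne, support_inter_prevRing]
    by_cases hN : ℓ + 1 < N
    · have := support_subset_interior_iff T (e := 0) (m := m) hN i
      rw [add_zero] at this
      rw [this]
      push Not
      simp [hN]
    · simp only [hN, false_imp_iff, iff_true]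
      rw [T.top (ℓ + 1) (by omega), interior_empty, subset_empty_iff]
      exact (support_nonempty ℓ m i).ne_empty
  unfold kraft
  rw [mem_sep_iff, h1, h2]
  exact ⟨fun h => ⟨h.2.2, h.2.1⟩, fun h => ⟨mem_range_self i, h.2, h.1⟩⟩

/-- The origin of the constants `r`: over `2 ^ (ℓ + 2)` the barycentre of a cell has numerators `2 c
+ 1` and that of its parent `2 (2 c' + 1)`. A sign pattern other than the one given by the parities
of `c` does not lead to a barycentre of level `ℓ`, so the existential quantifier admits no false
parent. -/
theorem cell_succ_subset_iff {ℓ : ℕ} (hℓ : ℓ + 1 < N) (c : Fin d → ℤ) :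
    cell (ℓ + 1) c ⊆ T.Ω (ℓ + 1) ↔
      ∃ (ε : Fin d → Bool) (c' : Fin d → ℤ), cell ℓ c' ⊆ T.Ω (ℓ + 1) ∧
        ∀ j, 2 * (2 * c' j + 1) = 2 * c j + 1 + if ε j then 1 else -1 := by
  constructor
  · intro h
    have hc := h (centre_mem_cell _ c)
    obtain ⟨M, hM, hΩ⟩ := T.composed ℓ hℓ
    rw [hΩ] at hc ⊢
    obtain ⟨C, hC, hcC⟩ := hc
    obtain ⟨c', rfl⟩ := hM hC
    -- The left half of the parent has its barycentre below that of the parent, hence the sign `+`;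
    -- the right half needs `-`.
    refine ⟨fun j => decide (c j = 2 * c' j), c', subset_sUnion_of_mem hC, fun j => ?_⟩
    have := (centre_mem_cell_iff (e := 1)).1 hcC j
    by_cases hj : c j = 2 * c' j
    · simp [hj]; ring
    · simp only [hj, decide_false, Bool.false_eq_true, if_false]
      omega
  · rintro ⟨ε, c', hc', h⟩
    refine (cell_subset_cell ((centre_mem_cell_iff (e := 1)).2 fun j => ?_)).trans hc'
    have := h j
    split_ifs at this <;> omega

end HierarchicalMesh

namespace HMesh

/-! ### The cells in the support, relative to the associated cell -/

/-- The cube `I_m` is made for this: its points are the offsets from the associated cell to the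
cells of the support, in both parities of `m + 1`. -/
theorem mem_indexCube_iff {d m : ℕ} {i c : Fin d → ℤ} :
    c - assocIndex m i ∈ indexCube d m ↔ ∀ j, i j ≤ c j ∧ c j ≤ i j + m := by
  rw [indexCube, Fintype.mem_piFinset]
  refine forall_congr' fun j => ?_
  rw [assocIndex]
  split_ifs with h
  · rw [Finset.mem_Icc, Pi.sub_apply]
    obtain ⟨a, ha⟩ := h
    omega
  · rw [Finset.mem_Icc, Pi.sub_apply]
    rw [Nat.not_odd_iff_even] at h
    obtain ⟨a, ha⟩ := h
    omega

theorem forall_supportCell_iff {d m : ℕ} (i : Fin d → ℤ) (p : (Fin d → ℤ) → Prop) :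
    (∀ c : Fin d → ℤ, (∀ j, i j ≤ c j ∧ c j ≤ i j + m) → p c) ↔
      ∀ τ ∈ indexCube d m, p (assocIndex m i + τ) := by
  constructor
  · intro h τ hτ
    exact h _ (mem_indexCube_iff.1 (by simpa using hτ))
  · intro h c hc
    simpa using h _ (mem_indexCube_iff.2 hc)

theorem assocIndex_surjective {d m : ℕ} : Function.Surjective (assocIndex (d := d) m) := by
  intro c
  unfold assocIndex
  split_ifs
  · exact ⟨fun j => c j - (m / 2 : ℕ), by simp⟩
  · exact ⟨fun j => c j - ((m + 1) / 2 : ℕ), by simp⟩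

end HMesh

/-! ### The domain languages in terms of numerators -/

namespace HierarchicalMesh

open HMesh

variable {d N : ℕ} (T : HierarchicalMesh d N)

theorem wordVec_mem_domainLang_iff {b : ℕ} [NeZero b] [Fact (2 ∣ b)] {ℓ : ℕ} {k : Fin d → ℤ} :
    wordVec b (gridVec b (ℓ + 1) k) ∈ T.domainLang b ℓ ↔
      ∃ c, cell ℓ c ⊆ T.Ω (ℓ + 1) ∧ k = fun j => 2 * c j + 1 := by
  constructor
  · rintro ⟨c, hc, h⟩
    exact ⟨c, hc, gridVec_injective _ (wordVec_injective (two_le_base b) h)⟩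
  · rintro ⟨c, hc, rfl⟩
    exact ⟨c, hc, rfl⟩

/-- The same language with one more factor 2 in the denominator, as needed when it is tested on
vectors of the next finer level. -/
theorem wordVec_succ_mem_domainLang_iff {b : ℕ} [NeZero b] [Fact (2 ∣ b)] {ℓ : ℕ}
    {k : Fin d → ℤ} :
    wordVec b (gridVec b (ℓ + 1 + 1) k) ∈ T.domainLang b ℓ ↔
      ∃ c, cell ℓ c ⊆ T.Ω (ℓ + 1) ∧ k = fun j => 2 * (2 * c j + 1) := by
  constructor
  · rintro ⟨c, hc, h⟩
    rw [barycentre, ← gridVec_succ (ℓ + 1)] at h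
    exact ⟨c, hc, gridVec_injective _ (wordVec_injective (two_le_base b) h)⟩
  · rintro ⟨c, hc, rfl⟩
    refine ⟨c, hc, ?_⟩
    rw [barycentre, ← gridVec_succ (ℓ + 1)]

end HierarchicalMesh

namespace HMesh

/-- The condition that a cell of level `ℓ` belongs to a B-spline of Kraft's selection, for a mesh
of `n + 1` levels: `k` is the vector of the numerators of the barycentre over `2 ^ (ℓ + 1)`, and
`A ℓ' k'` says that the vector with numerators `k'` is coded in the language `L_{ℓ'+1}`. -/
def Selected {d : ℕ} (m n ℓ : ℕ) (A : ℕ → (Fin d → ℤ) → Prop) (k : Fin d → ℤ) : Prop :=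
  (ℓ < n → ∃ τ ∈ indexCube d m, ¬ A ℓ fun j => k j + 2 * τ j) ∧
  (∀ ℓ', ℓ = ℓ' + 1 → ∀ τ ∈ indexCube d m, ∃ ε : Fin d → Bool,
    A ℓ' fun j => k j + 2 * τ j + if ε j then 1 else -1)

end HMesh

namespace HierarchicalMesh

open HMesh

variable {d N : ℕ} (T : HierarchicalMesh d N)

theorem tensorBspline_mem_kraft_iff_selected {b : ℕ} [NeZero b] [Fact (2 ∣ b)] {ℓ m : ℕ}
    (hℓ : ℓ < N) (i : Fin d → ℤ) : tensorBspline ℓ m i ∈ T.kraft m ℓ ↔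
      Selected m (N - 1) ℓ (fun ℓ' k => wordVec b (gridVec b (ℓ + 1) k) ∈ T.domainLang b ℓ')
        (fun j => 2 * assocIndex m i j + 1) := by
  rw [tensorBspline_mem_kraft_iff T hℓ, Selected]
  refine and_congr (imp_congr (by omega) ?_) (forall₂_congr fun ℓ' h => ?_)
  · rw [← not_iff_not]
    push Not
    rw [forall_supportCell_iff]
    refine forall₂_congr fun τ _ => ?_
    rw [wordVec_mem_domainLang_iff]
    constructor
    · intro h
      exact ⟨_, h, by funext j; simp; ring⟩
    · rintro ⟨c, hc, h⟩
      convert hc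
      funext j
      have := congrFun h j
      simp only [Pi.add_apply] at this ⊢
      omega
  · subst h
    rw [forall_supportCell_iff]
    refine forall₂_congr fun τ _ => ?_
    rw [cell_succ_subset_iff T hℓ]
    refine exists_congr fun ε => ?_
    rw [wordVec_succ_mem_domainLang_iff]
    refine exists_congr fun c' => and_congr_right fun _ => ?_
    rw [funext_iff]
    refine forall_congr' fun j => ?_
    simp only [Pi.add_apply]
    generalize (if ε j = true then (1 : ℤ) else -1) = e
    omega

theorem kraftLang_eq {b : ℕ} [NeZero b] [Fact (2 ∣ b)] {ℓ m : ℕ} (hℓ : ℓ < N) :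
    T.kraftLang b m ℓ = {w | ∃ c : Fin d → ℤ,
      Selected m (N - 1) ℓ (fun ℓ' k => wordVec b (gridVec b (ℓ + 1) k) ∈ T.domainLang b ℓ')
        (fun j => 2 * c j + 1) ∧ w = wordVec b (gridVec b (ℓ + 1) fun j => 2 * c j + 1)} := by
  ext w
  constructor
  · rintro ⟨i, hi, rfl⟩
    exact ⟨assocIndex m i, (tensorBspline_mem_kraft_iff_selected T hℓ i).1 hi, rfl⟩
  · rintro ⟨c, hc, rfl⟩
    obtain ⟨i, rfl⟩ := assocIndex_surjective (m := m) c
    exact ⟨i, (tensorBspline_mem_kraft_iff_selected T hℓ i).2 hc, rfl⟩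

end HierarchicalMesh

namespace HMesh

/-! ### The languages defined by the formulas -/

variable {b d N m : ℕ} [NeZero b] [Fact (2 ∣ b)] (T : HierarchicalMesh d N)

theorem mem_definedLang_iff {φ : (signature d m).Formula Unit} {w : List (Padded (Digits b) d)} :
    w ∈ definedLang b T φ ↔ ∃ z : Fin d → zinv b, w = wordVec b z ∧
      letI := meshStructure b T m
      φ.Realize fun _ => encode b z := by
  constructor
  · rintro ⟨⟨z, rfl⟩, h⟩
    exact ⟨z, rfl, h⟩
  · rintro ⟨z, rfl, h⟩
    exact ⟨mem_range_self z, h⟩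

theorem realize_cellFormula {ℓ : ℕ} {z : Fin d → zinv b} :
    letI := meshStructure b T m
    (cellFormula d m ℓ).Realize (fun _ => encode b z) ↔ ∃ i : Fin d → ℤ, z = barycentre b ℓ i := by
  let _ := meshStructure b T m
  have : (cellFormula d m ℓ).Realize (fun _ => encode b z) ↔ wordVec b z ∈ cellLang b d ℓ :=
    FirstOrder.Language.Formula.realize_rel₁
  rw [this]
  exact exists_congr fun i => ⟨fun h => wordVec_injective (two_le_base b) h, fun h => h ▸ rfl⟩

theorem realize_addMemFormula_t {ℓ : ℕ} {z : Fin d → zinv b} {i : indexCube d m} :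
    letI := meshStructure b T m
    (addMemFormula d m (Func.t ℓ i) ℓ).Realize (fun _ => encode b z) ↔
      wordVec b (z + gridVec b ℓ i) ∈ T.domainLang b ℓ := by
  let _ := meshStructure b T m
  have : (addMemFormula d m (Func.t ℓ i) ℓ).Realize (fun _ => encode b z) ↔
      wordVec b (decode b d (encode b z) + decode b d (encode b (gridVec b ℓ i))) ∈
        T.domainLang b ℓ :=
    FirstOrder.Language.Formula.realize_rel₁
  rw [this, decode_encode (two_le_base b), decode_encode (two_le_base b)]

theorem realize_addMemFormula_r {ℓ ℓ' : ℕ} {z : Fin d → zinv b} {i : indexCube d m}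
    {ε : Fin d → Bool} :
    letI := meshStructure b T m
    (addMemFormula d m (Func.r ℓ' i ε) ℓ).Realize (fun _ => encode b z) ↔
      wordVec b (z + (gridVec b ℓ' i + signVec b (ℓ' + 1) ε)) ∈ T.domainLang b ℓ := by
  let _ := meshStructure b T m
  have : (addMemFormula d m (Func.r ℓ' i ε) ℓ).Realize (fun _ => encode b z) ↔
      wordVec b (decode b d (encode b z) +
        decode b d (encode b (gridVec b ℓ' i + signVec b (ℓ' + 1) ε))) ∈ T.domainLang b ℓ :=
    FirstOrder.Language.Formula.realize_rel₁
  rw [this, decode_encode (two_le_base b), decode_encode (two_le_base b)]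

theorem realize_Psi {ℓ : ℕ} {k : Fin d → ℤ} :
    letI := meshStructure b T m
    (Psi d m ℓ).Realize (fun _ => encode b (gridVec b (ℓ + 1) k)) ↔
      ∃ τ ∈ indexCube d m,
        ¬ wordVec b (gridVec b (ℓ + 1) fun j => k j + 2 * τ j) ∈ T.domainLang b ℓ := by
  let _ := meshStructure b T m
  rw [Psi, FirstOrder.Language.Formula.realize_iSup]
  simp only [FirstOrder.Language.Formula.realize_not, realize_addMemFormula_t, Subtype.exists,
    exists_prop]
  refine exists_congr fun τ => and_congr_right fun _ => ?_
  rw [← gridVec_succ ℓ, ← gridVec_add]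
  exact Iff.rfl

theorem realize_insideSucc {ℓ : ℕ} {k : Fin d → ℤ} :
    letI := meshStructure b T m
    (insideSucc d m ℓ).Realize (fun _ => encode b (gridVec b (ℓ + 1 + 1) k)) ↔
      ∀ τ ∈ indexCube d m, ∃ ε : Fin d → Bool,
        wordVec b (gridVec b (ℓ + 1 + 1) fun j => k j + 2 * τ j + if ε j then 1 else -1) ∈
          T.domainLang b ℓ := by
  let _ := meshStructure b T m
  rw [insideSucc, FirstOrder.Language.Formula.realize_iInf]
  simp only [FirstOrder.Language.Formula.realize_iSup, realize_addMemFormula_r, Subtype.forall]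
  refine forall₂_congr fun τ _ => exists_congr fun ε => ?_
  rw [← gridVec_succ (ℓ + 1), signVec, ← gridVec_add, ← gridVec_add, ← add_assoc]
  exact Iff.rfl

/-- Membership in a language defined by a conjunction of `u ∈ L̃_ℓ^d` and another formula. -/
theorem definedLang_cellFormula_inf {ℓ : ℕ} {φ : (signature d m).Formula Unit}
    {p : (Fin d → ℤ) → Prop}
    (h : ∀ c : Fin d → ℤ, (letI := meshStructure b T m
      φ.Realize fun _ => encode b (barycentre b ℓ c)) ↔ p c) :
    definedLang b T (cellFormula d m ℓ ⊓ φ) =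
      {w | ∃ c : Fin d → ℤ, p c ∧ w = wordVec b (barycentre b ℓ c)} := by
  let _ := meshStructure b T m
  ext w
  rw [mem_definedLang_iff]
  simp only [FirstOrder.Language.Formula.realize_inf, realize_cellFormula]
  constructor
  · rintro ⟨z, rfl, ⟨c, rfl⟩, hφ⟩
    exact ⟨c, (h c).1 hφ, rfl⟩
  · rintro ⟨c, hc, rfl⟩
    exact ⟨_, rfl, ⟨c, rfl⟩, (h c).2 hc⟩

theorem definedLang_cellFormula {ℓ : ℕ} : definedLang b T (cellFormula d m ℓ) =
      {w | ∃ c : Fin d → ℤ, True ∧ w = wordVec b (barycentre b ℓ c)} := by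
  let _ := meshStructure b T m
  ext w
  rw [mem_definedLang_iff]
  simp only [realize_cellFormula]
  constructor
  · rintro ⟨z, rfl, ⟨c, rfl⟩⟩
    exact ⟨c, trivial, rfl⟩
  · rintro ⟨c, hc, rfl⟩
    exact ⟨_, rfl, ⟨c, rfl⟩⟩

theorem kraftLang_eq_definedLang_Theta {ℓ : ℕ} (hℓ : ℓ + 1 < N) :
    T.kraftLang b m ℓ = definedLang b T (Theta d m ℓ) := by
  let _ := meshStructure b T m
  rw [T.kraftLang_eq (by omega)]
  symm
  cases ℓ with
  | zero =>
    refine definedLang_cellFormula_inf T fun c => ?_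
    rw [barycentre, realize_Psi, Selected]
    have : 0 < N - 1 := by omega
    simp [this]
  | succ ℓ =>
    refine definedLang_cellFormula_inf T fun c => ?_
    rw [FirstOrder.Language.Formula.realize_inf, barycentre, realize_Psi, realize_insideSucc,
      Selected]
    refine and_congr ?_ ?_
    · have : ℓ + 1 < N - 1 := by omega
      simp [this]
    · simp

theorem kraftLang_eq_definedLang_Gamma :
    T.kraftLang b m (N - 1) = definedLang b T (Gamma d m (N - 1)) := by
  have hN := T.pos_levels
  rw [T.kraftLang_eq (by omega)]
  symm
  -- At the top level the guard `ℓ < N - 1` of the first half of `Selected` becomes `ℓ < ℓ`, so only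
  -- the condition on `Ω^ℓ` survives.
  generalize N - 1 = ℓ
  cases ℓ with
  | zero =>
    refine (definedLang_cellFormula T).trans ?_
    simp [Selected, barycentre]
    rfl
  | succ ℓ =>
    refine definedLang_cellFormula_inf T fun c => ?_
    rw [barycentre, realize_insideSucc, Selected]
    simp

end HMesh

namespace HMesh

/-! ### Runs of automata on streams of symbols -/

section Runs

variable {σ Q : Type} {d : ℕ}

open Classical in
/-- One step of an automaton, where the symbol `(⋄, …, ⋄)` does not change the state. -/
noncomputable def stepPadded (M : DFA (Padded σ d) Q) (q : Q) (a : Fin d → Option σ) : Q :=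
  if h : ∃ j, a j ≠ none then M.step q ⟨a, h⟩ else q

/-- The state of an automaton after the first `n` symbols of a stream. -/
noncomputable def runStream (M : DFA (Padded σ d) Q) (q : Q) (s : ℕ → Fin d → Option σ) : ℕ → Q
  | 0 => q
  | n + 1 => runStream M (stepPadded M q (s 0)) (fun p => s (p + 1)) n

theorem runStream_add (M : DFA (Padded σ d) Q) (q : Q) (s : ℕ → Fin d → Option σ) (n e : ℕ) :
    runStream M q s (n + e) = runStream M (runStream M q s n) (fun p => s (n + p)) e := by
  induction n generalizing q s with
  | zero => simp [runStream]
  | succ n ih =>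
    rw [Nat.add_right_comm, runStream, ih, runStream]
    simp only [Nat.add_right_comm]

theorem runStream_congr (M : DFA (Padded σ d) Q) (q : Q) {s s' : ℕ → Fin d → Option σ} {n : ℕ}
    (h : ∀ p < n, s p = s' p) : runStream M q s n = runStream M q s' n := by
  induction n generalizing q s s' with
  | zero => rfl
  | succ n ih =>
    rw [runStream, runStream, h 0 (by omega)]
    exact ih _ fun p hp => h (p + 1) (by omega)

theorem symbolAt_cons_succ (a : Padded σ d) (w : List (Padded σ d)) (p : ℕ) :
    symbolAt (a :: w) (p + 1) = symbolAt w p := by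
  simp [symbolAt]

/-- The symbol `(⋄, …, ⋄)` leaves the state unchanged, so a run may continue past the end of the
word. Words of different lengths can thus be compared by streams. -/
theorem runStream_symbolAt (M : DFA (Padded σ d) Q) (q : Q) (w : List (Padded σ d)) {n : ℕ}
    (h : w.length ≤ n) : runStream M q (symbolAt w) n = M.evalFrom q w := by
  induction n generalizing q w with
  | zero =>
    have : w = [] := List.eq_nil_of_length_eq_zero (by omega)
    subst this
    rfl
  | succ n ih =>
    rw [runStream]
    cases w with
    | nil =>
      have h0 : stepPadded M q (symbolAt [] 0) = q := by simp [stepPadded, symbolAt]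
      rw [h0]
      exact ih q [] (Nat.zero_le _)
    | cons a w =>
      have h0 : stepPadded M q (symbolAt (a :: w) 0) = M.step q a := by
        rw [stepPadded, dif_pos (by simpa [symbolAt] using a.2)]
        simp [symbolAt]
      rw [h0]
      simp only [symbolAt_cons_succ]
      rw [ih _ w (by simpa using h), DFA.evalFrom_cons]

theorem eval_eq_of_tail_eq (M : DFA (Padded σ d) Q) {w w' : List (Padded σ d)} {n n' : ℕ}
    (hrun : runStream M M.start (symbolAt w) n = runStream M M.start (symbolAt w') n')
    (htail : ∀ e, symbolAt w (n + e) = symbolAt w' (n' + e)) : M.eval w = M.eval w' := by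
  have h1 := runStream_symbolAt M M.start w (n := n + (w.length + w'.length)) (by omega)
  have h2 := runStream_symbolAt M M.start w' (n := n' + (w.length + w'.length)) (by omega)
  rw [runStream_add] at h1 h2
  refine h1.symm.trans (Eq.trans ?_ h2)
  rw [hrun]
  exact runStream_congr _ _ fun p _ => htail p

theorem symbolAt_append_left {u t : List (Padded σ d)} {p : ℕ} (h : p < u.length) :
    symbolAt (u ++ t) p = symbolAt u p := by
  rw [symbolAt, symbolAt, List.map_append, List.getD_append _ _ _ _ (by simpa using h)]

theorem symbolAt_append_right {u t : List (Padded σ d)} (e : ℕ) :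
    symbolAt (u ++ t) (u.length + e) = symbolAt t e := by
  rw [symbolAt, symbolAt, List.map_append, List.getD_append_right _ _ _ _ (by simp)]
  simp

end Runs

/-! ### Low and high digits -/

section Digits

variable {b : ℕ} [NeZero b]

/-- Multiples of `2 ^ L * b ^ n` affect no digit in these positions. The high part matters only
through being zero or not: if it is nonzero the word has not ended by position `n`, and if it is
zero the low part is the whole number. -/
theorem digitSymbol_eq_of_low_eq (hb : 2 ≤ b) {L n : ℕ} {s : Bool} {A A' : ℕ}
    (hlow : A % (2 ^ L * b ^ n) = A' % (2 ^ L * b ^ n))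
    (hzero : A / (2 ^ L * b ^ n) = 0 ↔ A' / (2 ^ L * b ^ n) = 0) {p : ℕ} (hp : p ≤ n) :
    digitSymbol b L s A p = digitSymbol b L s A' p := by
  cases p with
  | zero => rfl
  | succ i =>
    have hN : 0 < 2 ^ L * b ^ n := by positivity
    by_cases h0 : A / (2 ^ L * b ^ n) = 0
    · have h0' := hzero.1 h0
      have : A = A' := by
        rw [← Nat.div_add_mod A (2 ^ L * b ^ n), ← Nat.div_add_mod A' (2 ^ L * b ^ n), hlow, h0, h0']
      rw [this]
    · have h0' := fun h => h0 (hzero.2 h)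
      have key : ∀ B : ℕ, B / (2 ^ L * b ^ n) ≠ 0 → digitSymbol b L s B (i + 1) =
          some (Fin.ofNat b (B % (2 ^ L * b ^ n) / 2 ^ L / b ^ i),
            Fin.ofNat b (B % (2 ^ L * b ^ n) * b ^ (i + 1) / 2 ^ L)) := by
        intro B hB
        have hle : 2 ^ L * b ^ n ≤ B := by
          by_contra h
          exact hB (Nat.div_eq_of_lt (not_le.1 h))
        have hpow : b ^ i * 2 ^ L ≤ B := by
          refine le_trans ?_ hle
          rw [mul_comm]
          exact Nat.mul_le_mul_left _ (Nat.pow_le_pow_right (by omega) (by omega))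
        rw [digitSymbol, if_neg fun h => absurd h.1 (not_lt.2 hpow)]
        obtain ⟨e, rfl⟩ := Nat.exists_eq_add_of_le hp
        generalize hr : B % (2 ^ L * b ^ (i + 1 + e)) = r
        generalize hh : B / (2 ^ L * b ^ (i + 1 + e)) = h
        have hB' : B = r + 2 ^ L * b ^ (i + 1 + e) * h := by
          rw [← hr, ← hh, Nat.mod_add_div]
        have e1 : B / 2 ^ L / b ^ i = r / 2 ^ L / b ^ i + b * (b ^ e * h) := by
          rw [Nat.div_div_eq_div_mul, Nat.div_div_eq_div_mul, hB',
            show r + 2 ^ L * b ^ (i + 1 + e) * h = r + 2 ^ L * b ^ i * (b * (b ^ e * h)) by ring,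
            Nat.add_mul_div_left _ _ (by positivity)]
        have e2 : B * b ^ (i + 1) / 2 ^ L =
            r * b ^ (i + 1) / 2 ^ L + b * (b ^ (i + 1 + e) * h * b ^ i) := by
          rw [hB', show (r + 2 ^ L * b ^ (i + 1 + e) * h) * b ^ (i + 1) =
            r * b ^ (i + 1) + 2 ^ L * (b * (b ^ (i + 1 + e) * h * b ^ i)) by ring,
            Nat.add_mul_div_left _ _ (by positivity)]
        rw [e2, e1]
        congr 2
        · rw [ofNat_inj_mod, Nat.add_mul_mod_self_left]
        · rw [ofNat_inj_mod, Nat.add_mul_mod_self_left]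
      rw [key A h0, key A' h0', hlow]

/-- The symbols of a word that follow the position `n + 1`, in terms of the number `h` that is
given by the digits from this position on. -/
def tailSymbol (b : ℕ) [NeZero b] (h e : ℕ) : Option (Digits b) :=
  if h < b ^ e then none else some (Fin.ofNat b (h / b ^ e), 0)

/-- For `n ≥ L` the power `2 ^ L` divides `b ^ n`, so the fractional expansion is finished and only
the integral digits of the high part remain. The evenness of `b` is essential here. -/
theorem digitSymbol_tail [hb : Fact (2 ∣ b)] {L n : ℕ} (hL : L ≤ n) (s : Bool) (A e : ℕ) :
    digitSymbol b L s A (n + 1 + e) = tailSymbol b (A / (2 ^ L * b ^ n)) e := by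
  have hb0 : 0 < b := Nat.pos_of_ne_zero (NeZero.ne b)
  obtain ⟨c, hc⟩ : 2 ^ L ∣ b ^ n := (pow_dvd_pow_of_dvd hb.out L).trans (pow_dvd_pow b hL)
  have h1 : A < b ^ (n + e) * 2 ^ L ↔ A / (2 ^ L * b ^ n) < b ^ e := by
    rw [Nat.div_lt_iff_lt_mul (by positivity)]
    rw [show b ^ e * (2 ^ L * b ^ n) = b ^ (n + e) * 2 ^ L by ring]
  have h2 : A * b ^ (n + e) % 2 ^ L = 0 := by
    rw [pow_add, hc, show A * (2 ^ L * c * b ^ e) = 2 ^ L * (A * c * b ^ e) by ring]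
    exact Nat.mul_mod_right _ _
  have h3 : A / 2 ^ L / b ^ (n + e) = A / (2 ^ L * b ^ n) / b ^ e := by
    rw [Nat.div_div_eq_div_mul, Nat.div_div_eq_div_mul, pow_add, mul_assoc]
  have h4 : Fin.ofNat b (A * b ^ (n + e + 1) / 2 ^ L) = 0 := by
    rw [ofNat_eq_zero_iff, show A * b ^ (n + e + 1) = A * (b ^ n * b ^ e * b) by ring, hc,
      show A * (2 ^ L * c * b ^ e * b) = 2 ^ L * (b * (A * c * b ^ e)) by ring,
      Nat.mul_div_cancel_left _ (by positivity)]
    exact Nat.mul_mod_right _ _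
  rw [show n + 1 + e = n + e + 1 by ring, digitSymbol, tailSymbol, h3, h4]
  simp only [h1, h2, and_true]

/-- The integer with the sign and the low digits of `k` and the high digits of `h`. -/
def replaceHigh (N : ℕ) (k : ℤ) (h : ℕ) : ℤ :=
  if k < 0 then -((k.natAbs % N + N * h : ℕ) : ℤ) else ((k.natAbs % N + N * h : ℕ) : ℤ)

/-- High parts that agree up to the cutoff 2 are either equal, and then nothing changes, or both at
least 2. -/
theorem replaceHigh_eq_or {N : ℕ} {k : ℤ} {h : ℕ} (hh : min h 2 = min (k.natAbs / N) 2) :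
    (h = k.natAbs / N ∧ replaceHigh N k h = k) ∨
    (∃ h₁ h₂ r : ℕ, h = h₁ + 2 ∧ k.natAbs / N = h₂ + 2 ∧
      ((0 ≤ k ∧ k = r + N * (h₂ + 2) ∧ replaceHigh N k h = r + N * (h₁ + 2)) ∨
      (k < 0 ∧ k = -(r + N * (h₂ + 2)) ∧ replaceHigh N k h = -(r + N * (h₁ + 2))))) := by
  have hk := Nat.mod_add_div k.natAbs N
  by_cases hlt : 2 ≤ h
  · right
    obtain ⟨h₁, hh₁⟩ := Nat.exists_eq_add_of_le hlt
    obtain ⟨h₂, hh₂⟩ := Nat.exists_eq_add_of_le (show 2 ≤ k.natAbs / N by omega)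
    refine ⟨h₁, h₂, k.natAbs % N, by omega, by omega, ?_⟩
    rw [hh₂, add_comm 2 h₂] at hk
    have hz : (k.natAbs : ℤ) = ((k.natAbs % N : ℕ) : ℤ) + N * (h₂ + 2) := by exact_mod_cast hk.symm
    rw [replaceHigh, hh₁]
    rcases lt_or_ge k 0 with hk0 | hk0
    · right
      refine ⟨hk0, by omega, ?_⟩
      rw [if_pos hk0]
      push_cast
      ring
    · left
      refine ⟨hk0, by omega, ?_⟩
      rw [if_neg (not_lt.2 hk0)]
      push_cast
      ring
  · left
    have : h = k.natAbs / N := by omega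
    refine ⟨this, ?_⟩
    rw [replaceHigh, this, hk]
    split_ifs <;> omega

theorem natAbs_div_mod_of_eq {N : ℕ} (hN : 0 < N) {x : ℤ} {u h : ℕ}
    (hx : x = u + N * h ∨ x = -(u + N * h : ℤ)) :
    x.natAbs / N = u / N + h ∧ x.natAbs % N = u % N := by
  have : x.natAbs = u + N * h := by
    have h0 : (0 : ℤ) ≤ N * h := by positivity
    zify
    rcases hx with rfl | rfl
    · rw [abs_of_nonneg (by positivity)]
    · rw [abs_neg, abs_of_nonneg (by positivity)]
  rw [this, Nat.add_mul_div_left _ _ hN, Nat.add_mul_mod_self_left]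
  exact ⟨rfl, rfl⟩

/-- Why the cutoff is 2: a translation by less than `N` lowers the high part by at most one, so from
2 on it stays positive and the sign is kept. The low part and the carry then do not depend on the
high part. The last clause equates the two carries without subtraction. -/
theorem replaceHigh_add {N : ℕ} {k : ℤ} {h : ℕ} (hh : min h 2 = min (k.natAbs / N) 2) {x : ℤ}
    (hx : x.natAbs < N) :
    (replaceHigh N k h + x < 0 ↔ k + x < 0) ∧
    (replaceHigh N k h + x).natAbs % N = (k + x).natAbs % N ∧
    ((replaceHigh N k h + x).natAbs / N = 0 ↔ (k + x).natAbs / N = 0) ∧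
    (replaceHigh N k h + x).natAbs / N + k.natAbs / N = (k + x).natAbs / N + h := by
  have hN : 0 < N := by omega
  rcases replaceHigh_eq_or hh with ⟨h1, h2⟩ | ⟨h₁, h₂, r, hh₁, hh₂, h3⟩
  · rw [h2, ← h1]
    simp
  · have hxa : -(N : ℤ) < x ∧ x < N := by omega
    have p1 : (0 : ℤ) ≤ N * h₁ := by positivity
    have p2 : (0 : ℤ) ≤ N * h₂ := by positivity
    subst hh₁
    rw [hh₂]
    rcases h3 with ⟨-, e1, e2⟩ | ⟨-, e1, e2⟩
    -- One `N` is borrowed from the high part to make `r + x + N` nonnegative. The same `u` serves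
    -- both numbers, with the remaining multiples `h₁ + 1` and `h₂ + 1`.
    · obtain ⟨u, hu⟩ := Int.eq_ofNat_of_zero_le (show 0 ≤ r + x + N by omega)
      have a1 := natAbs_div_mod_of_eq hN (x := replaceHigh N k (h₁ + 2) + x) (u := u) (h := h₁ + 1)
        (Or.inl (by rw [e2]; push_cast; linarith))
      have a2 := natAbs_div_mod_of_eq hN (x := k + x) (u := u) (h := h₂ + 1)
        (Or.inl (by rw [e1]; push_cast; linarith))
      rw [a1.1, a1.2, a2.1, a2.2]
      refine ⟨?_, rfl, iff_of_false (Nat.succ_ne_zero _) (Nat.succ_ne_zero _), by ring⟩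
      rw [e2, e1]
      constructor <;> intro h <;> nlinarith [hxa.1, hxa.2]
    · obtain ⟨u, hu⟩ := Int.eq_ofNat_of_zero_le (show 0 ≤ r - x + N by omega)
      have a1 := natAbs_div_mod_of_eq hN (x := replaceHigh N k (h₁ + 2) + x) (u := u) (h := h₁ + 1)
        (Or.inr (by rw [e2]; push_cast; linarith))
      have a2 := natAbs_div_mod_of_eq hN (x := k + x) (u := u) (h := h₂ + 1)
        (Or.inr (by rw [e1]; push_cast; linarith))
      rw [a1.1, a1.2, a2.1, a2.2]
      refine ⟨?_, rfl, iff_of_false (Nat.succ_ne_zero _) (Nat.succ_ne_zero _), by ring⟩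
      rw [e2, e1]
      constructor <;> intro h <;> nlinarith [hxa.1, hxa.2]

theorem natAbs_add_div_bounds {N : ℕ} {k x : ℤ} (hx : x.natAbs < N) :
    k.natAbs / N ≤ (k + x).natAbs / N + 1 ∧ (k + x).natAbs / N ≤ k.natAbs / N + 1 := by
  have hN : 0 < N := by omega
  rw [← Nat.add_div_right _ hN, ← Nat.add_div_right _ hN]
  exact ⟨Nat.div_le_div_right (by omega), Nat.div_le_div_right (by omega)⟩

end Digits

end HMesh

namespace HMesh

/-! ### The languages defined by tests of translates have finite index -/

section FiniteIndex

variable {b d : ℕ} [NeZero b] {ι Q : Type}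

/-- The vectors `k / 2 ^ L` with odd numerators that satisfy a condition on the states an automaton
reaches on finitely many translates, as a language. -/
def translateLang [Fact (2 ∣ b)] (L : ℕ) (M : DFA (Padded (Digits b) d) Q) (v : ι → Fin d → ℤ)
    (R : (ι → Q) → Prop) : Language (Padded (Digits b) d) :=
  {w | ∃ k : Fin d → ℤ, (∀ j, Odd (k j)) ∧
    R (fun i => M.eval (wordVec b (gridVec b L (k + v i)))) ∧ w = wordVec b (gridVec b L k)}

/-- The information on the numerators `k` that is relevant beyond the first `n + 1` symbols. -/
abbrev PrefixData (d : ℕ) (ι Q : Type) : Type :=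
  (Fin d → Fin 3) × (Fin d → Bool) × (ι → Q × (Fin d → Fin 3))

/-- The relevant information for the first `n + 1` symbols: the high parts of the coordinates, as
far as they are less than `2`, the parities, and for each translate the state reached and the
carries to the high parts. -/
noncomputable def prefixData (L : ℕ) (M : DFA (Padded (Digits b) d) Q) (v : ι → Fin d → ℤ)
    (k : Fin d → ℤ) (n : ℕ) : PrefixData d ι Q :=
  (fun j => ⟨min ((k j).natAbs / (2 ^ L * b ^ n)) 2, by omega⟩, fun j => decide (Odd (k j)),
    fun i => (runStream M M.start (gridSymbol b L (k + v i)) (n + 1), fun j =>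
      Fin.ofNat 3 ((k j + v i j).natAbs / (2 ^ L * b ^ n) + 1 - (k j).natAbs / (2 ^ L * b ^ n))))

theorem min_eq_of_prefixData_eq {L : ℕ} {M : DFA (Padded (Digits b) d) Q} {v : ι → Fin d → ℤ}
    {k k' : Fin d → ℤ} {n n' : ℕ} (h : prefixData L M v k n = prefixData L M v k' n') (j : Fin d) :
    min ((k j).natAbs / (2 ^ L * b ^ n)) 2 = min ((k' j).natAbs / (2 ^ L * b ^ n')) 2 :=
  congrArg Fin.val (congrFun (congrArg Prod.fst h) j)

theorem odd_iff_of_prefixData_eq {L : ℕ} {M : DFA (Padded (Digits b) d) Q} {v : ι → Fin d → ℤ}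
    {k k' : Fin d → ℤ} {n n' : ℕ} (h : prefixData L M v k n = prefixData L M v k' n') (j : Fin d) :
    Odd (k j) ↔ Odd (k' j) :=
  decide_eq_decide.1 (congrFun (congrArg (fun D => D.2.1) h) j)

theorem runStream_eq_of_prefixData_eq {L : ℕ} {M : DFA (Padded (Digits b) d) Q}
    {v : ι → Fin d → ℤ} {k k' : Fin d → ℤ} {n n' : ℕ}
    (h : prefixData L M v k n = prefixData L M v k' n') (i : ι) :
    runStream M M.start (gridSymbol b L (k + v i)) (n + 1) =
      runStream M M.start (gridSymbol b L (k' + v i)) (n' + 1) :=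
  congrArg Prod.fst (congrFun (congrArg (fun D => D.2.2) h) i)

/-- Carries are stored as elements of `{0, 1, 2}` after adding 1. Since a carry is at least `-1` and
at most `1`, neither the truncated subtraction nor the reduction modulo 3 loses information. -/
theorem carry_eq_of_prefixData_eq {L : ℕ} {M : DFA (Padded (Digits b) d) Q} {v : ι → Fin d → ℤ}
    {k k' : Fin d → ℤ} {n n' : ℕ} (h : prefixData L M v k n = prefixData L M v k' n') (i : ι)
    (j : Fin d) (hv : (v i j).natAbs < 2 ^ L * b ^ n) (hv' : (v i j).natAbs < 2 ^ L * b ^ n') :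
    (k j + v i j).natAbs / (2 ^ L * b ^ n) + (k' j).natAbs / (2 ^ L * b ^ n') =
      (k' j + v i j).natAbs / (2 ^ L * b ^ n') + (k j).natAbs / (2 ^ L * b ^ n) := by
  have h1 : Fin.ofNat 3
      ((k j + v i j).natAbs / (2 ^ L * b ^ n) + 1 - (k j).natAbs / (2 ^ L * b ^ n)) = Fin.ofNat 3
      ((k' j + v i j).natAbs / (2 ^ L * b ^ n') + 1 - (k' j).natAbs / (2 ^ L * b ^ n')) :=
    congrFun (congrArg Prod.snd (congrFun (congrArg (fun D => D.2.2) h) i)) j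
  have h2 := natAbs_add_div_bounds (k := k j) hv
  have h3 := natAbs_add_div_bounds (k := k' j) hv'
  rw [ofNat_inj_mod] at h1
  generalize (k j + v i j).natAbs / (2 ^ L * b ^ n) = x1 at *
  generalize (k j).natAbs / (2 ^ L * b ^ n) = x2 at *
  generalize (k' j + v i j).natAbs / (2 ^ L * b ^ n') = x3 at *
  generalize (k' j).natAbs / (2 ^ L * b ^ n') = x4 at *
  omega

/-- If the numerators `k'` agree with `k` as far as `prefixData` is concerned, then there are
numerators with the first symbols of `k'` and the further symbols of `k`. -/
theorem exists_replaceHigh [Fact (2 ∣ b)] {L : ℕ} (hL : 0 < L) {M : DFA (Padded (Digits b) d) Q}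
    {v : ι → Fin d → ℤ} {k k' : Fin d → ℤ} {n n' : ℕ} (hn : L ≤ n) (hn' : L ≤ n')
    (hv : ∀ i j, (v i j).natAbs < 2 ^ L * b ^ n) (hv' : ∀ i j, (v i j).natAbs < 2 ^ L * b ^ n')
    (h : prefixData L M v k n = prefixData L M v k' n') :
    ∃ x : Fin d → ℤ, (∀ j, Odd (x j) ↔ Odd (k j)) ∧
      (∀ p ≤ n', gridSymbol b L x p = gridSymbol b L k' p) ∧
      (∀ e, gridSymbol b L x (n' + 1 + e) = gridSymbol b L k (n + 1 + e)) ∧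
      ∀ i, M.eval (wordVec b (gridVec b L (x + v i))) =
        M.eval (wordVec b (gridVec b L (k + v i))) := by
  have hb := two_le_base b
  have hN' : 0 < 2 ^ L * b ^ n' := by positivity
  have hmin := fun j => min_eq_of_prefixData_eq h j
  -- Sign and low digits come from `k'`, the high part from `k`.
  let x : Fin d → ℤ := fun j => replaceHigh (2 ^ L * b ^ n') (k' j) ((k j).natAbs / (2 ^ L * b ^ n))
  have hx0 := fun j => replaceHigh_add (hmin j) (x := 0) (by rwa [Int.natAbs_zero])
  simp only [add_zero] at hx0
  have hhigh : ∀ j, (x j).natAbs / (2 ^ L * b ^ n') = (k j).natAbs / (2 ^ L * b ^ n) := fun j => by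
    have := (hx0 j).2.2.2
    change (x j).natAbs / (2 ^ L * b ^ n') + _ = _ at this
    omega
  refine ⟨x, fun j => ?_, fun p hp => ?_, fun e => ?_, fun i => ?_⟩
  · rw [odd_iff_of_prefixData_eq h j, ← Int.natAbs_odd, ← Int.natAbs_odd]
    -- As the modulus is even, the parity is visible in the low part, where `x` agrees with `k'`.
    have h2 : 2 ∣ (2 ^ L * b ^ n') := (dvd_pow_self 2 hL.ne').mul_right _
    have := congrArg (· % 2) (hx0 j).2.1
    rw [Nat.mod_mod_of_dvd _ h2, Nat.mod_mod_of_dvd _ h2] at this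
    rw [Nat.odd_iff, Nat.odd_iff]
    change (x j).natAbs % 2 = _ at this
    rw [this]
  · funext j
    have := digitSymbol_eq_of_low_eq hb (s := decide (x j < 0)) (hx0 j).2.1 (hx0 j).2.2.1 hp
    refine this.trans ?_
    have hs : decide (x j < 0) = decide (k' j < 0) := decide_eq_decide.2 (hx0 j).1
    rw [hs]
    rfl
  · funext j
    rw [gridSymbol, gridSymbol, digitSymbol_tail hn', digitSymbol_tail hn, hhigh j]
  · refine eval_eq_of_tail_eq M (n := n' + 1) (n' := n + 1) ?_ fun e => ?_
    · have e1 : ∀ y : Fin d → ℤ,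
          symbolAt (wordVec b (gridVec b L y)) = gridSymbol b L y := fun y =>
        funext fun p => symbolAt_wordVec_gridVec L y p
      rw [e1, e1, runStream_eq_of_prefixData_eq h i]
      refine runStream_congr _ _ fun p hp => ?_
      funext j
      have hxv := replaceHigh_add (hmin j) (hv' i j)
      have := digitSymbol_eq_of_low_eq hb (s := decide (x j + v i j < 0)) hxv.2.1 hxv.2.2.1
        (show p ≤ n' by omega)
      refine this.trans ?_
      have hs : decide (x j + v i j < 0) = decide (k' j + v i j < 0) := decide_eq_decide.2 hxv.1
      rw [hs]
      rfl
    · rw [symbolAt_wordVec_gridVec, symbolAt_wordVec_gridVec]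
      funext j
      rw [gridSymbol, gridSymbol, digitSymbol_tail hn', digitSymbol_tail hn]
      have h4 := (replaceHigh_add (hmin j) (hv' i j)).2.2.2
      change (x j + v i j).natAbs / (2 ^ L * b ^ n') + (k' j).natAbs / (2 ^ L * b ^ n') = _ at h4
      have h5 := carry_eq_of_prefixData_eq h i j (hv i j) (hv' i j)
      congr 1
      change (x j + v i j).natAbs / (2 ^ L * b ^ n') = (k j + v i j).natAbs / (2 ^ L * b ^ n)
      omega

open Classical in
/-- A map to a finite type that determines the left quotient of the language. -/
noncomputable def prefixClass (L n₀ : ℕ) (M : DFA (Padded (Digits b) d) Q) (v : ι → Fin d → ℤ)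
    (u : List (Padded (Digits b) d)) :
    (Fin (n₀ + 1) → Option (Padded (Digits b) d)) ⊕ Set (PrefixData d ι Q) :=
  if u.length ≤ n₀ then Sum.inl fun i => u[(i : ℕ)]? else
    Sum.inr {D | ∃ k : Fin d → ℤ, (∀ p < u.length, symbolAt u p = gridSymbol b L k p) ∧
      D = prefixData L M v k (u.length - 1)}

/-- A word `u ++ t` of the language comes from some `k`, whose datum is possible for `u` and hence
for `u'`, realized by some `k'`. Splicing `k'` below with `k` above gives a vector coded by `u' ++
t` whose translates reach the same states. Short prefixes are remembered verbatim. -/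
theorem append_mem_translateLang_of_prefixClass_eq [Fact (2 ∣ b)] {L n₀ : ℕ} (hL : 0 < L) (hn₀ : L ≤ n₀)
    {M : DFA (Padded (Digits b) d) Q} {v : ι → Fin d → ℤ}
    (hv : ∀ i j, (v i j).natAbs < 2 ^ L * b ^ n₀) {R : (ι → Q) → Prop}
    {u u' t : List (Padded (Digits b) d)} (h : prefixClass L n₀ M v u = prefixClass L n₀ M v u')
    (hu : u ++ t ∈ translateLang L M v R) : u' ++ t ∈ translateLang L M v R := by
  unfold prefixClass at h
  split_ifs at h with h1 h2 h2
  · have h3 := Sum.inl.inj h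
    have : u = u' := by
      refine List.ext_getElem? fun i => ?_
      by_cases hi : i < n₀ + 1
      · exact congrFun h3 ⟨i, hi⟩
      · rw [List.getElem?_eq_none (by omega), List.getElem?_eq_none (by omega)]
    rwa [← this]
  · obtain ⟨k, hodd, hR, hk⟩ := hu
    rw [eq_wordVec_gridVec_iff] at hk
    have h3 := Sum.inr.inj h
    -- A prefix of length `n + 1` consists of the sign and `n` digit pairs, hence the index
    -- `u.length - 1`.
    have h4 : prefixData L M v k (u.length - 1) ∈
        {D | ∃ k : Fin d → ℤ, (∀ p < u.length, symbolAt u p = gridSymbol b L k p) ∧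
          D = prefixData L M v k (u.length - 1)} :=
      ⟨k, fun p hp => by rw [← hk, symbolAt_append_left hp], rfl⟩
    rw [h3] at h4
    obtain ⟨k', hk', hD⟩ := h4
    have hvn : ∀ n, n₀ ≤ n → ∀ i j, (v i j).natAbs < 2 ^ L * b ^ n := fun n hn i j =>
      (hv i j).trans_le (Nat.mul_le_mul_left _
        (Nat.pow_le_pow_right (Nat.pos_of_ne_zero (NeZero.ne b)) hn))
    obtain ⟨x, hx1, hx2, hx3, hx4⟩ := exists_replaceHigh hL (by omega) (by omega)
      (hvn _ (by omega)) (hvn _ (by omega)) hD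
    refine ⟨x, fun j => (hx1 j).2 (hodd j), ?_, ?_⟩
    · simpa only [hx4] using hR
    · rw [eq_wordVec_gridVec_iff]
      intro p
      by_cases hp : p < u'.length
      · rw [symbolAt_append_left hp, hk' p hp, hx2 p (by omega)]
      · obtain ⟨e, rfl⟩ := Nat.exists_eq_add_of_le (not_lt.1 hp)
        have e1 : u'.length - 1 + 1 = u'.length := by omega
        have e2 : u.length - 1 + 1 = u.length := by omega
        have := hx3 e
        rw [e1, e2, ← hk, symbolAt_append_right] at this
        rw [symbolAt_append_right, this]

end FiniteIndex

open Classical in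
theorem card_prefixClass {b d : ℕ} {ι Q : Type} [Fintype ι] [Fintype Q] (n₀ : ℕ) :
    Nat.card ((Fin (n₀ + 1) → Option (Padded (Digits b) d)) ⊕ Set (PrefixData d ι Q)) =
      (Fintype.card (Padded (Digits b) d) + 1) ^ (n₀ + 1) +
        2 ^ (3 ^ d * (2 ^ d * (Fintype.card Q * 3 ^ d) ^ Fintype.card ι)) := by
  rw [Nat.card_eq_fintype_card]
  simp [Fintype.card_set]

end HMesh

namespace HMesh

/-! ### Automata from a membership test and a bound for the number of left quotients -/

/-- A pumping argument: two prefixes with the same value under `f` allow the factor between them to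
be cut out. -/
theorem exists_length_le_card {α S : Type} [Fintype S] (f : List α → S) {p : List α → Prop}
    (hf : ∀ u v t, f u = f v → p (u ++ t) → p (v ++ t)) {t : List α} (ht : p t) :
    ∃ t, t.length ≤ Fintype.card S ∧ p t := by
  induction hn : t.length using Nat.strong_induction_on generalizing t with
  | _ n ih =>
    by_cases hle : t.length ≤ Fintype.card S
    · exact ⟨t, hle, ht⟩
    · obtain ⟨i, j, hij, hfij⟩ : ∃ i j : Fin t.length, i < j ∧ f (t.take i) = f (t.take j) := by
        obtain ⟨i, j, hne, h⟩ := Fintype.exists_ne_map_eq_of_card_lt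
          (fun i : Fin t.length => f (t.take i)) (by simpa using hle)
        rcases lt_or_gt_of_ne hne with h' | h'
        · exact ⟨i, j, h', h⟩
        · exact ⟨j, i, h', h.symm⟩
      have hij' : (i : ℕ) < j := hij
      have hp : p (t.take i ++ t.drop j) := by
        refine hf _ _ _ hfij.symm ?_
        rwa [List.take_append_drop]
      refine ih _ ?_ hp rfl
      rw [List.length_append, List.length_take, List.length_drop]
      omega

/-! ### Enumeration of words of bounded length -/

section Words

variable (α : Type) [Fintype α]

/-- The list of all words of length at most `n`. -/
noncomputable def wordsUpTo : ℕ → List (List α)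
  | 0 => [ [] ]
  | n + 1 => [] :: (wordsUpTo n).flatMap fun w => (Finset.univ : Finset α).toList.map fun a => a :: w

theorem mem_wordsUpTo {n : ℕ} {w : List α} : w ∈ wordsUpTo α n ↔ w.length ≤ n := by
  induction n generalizing w with
  | zero => simp [wordsUpTo]
  | succ n ih => cases w <;> simp [wordsUpTo, ih]

theorem wordsUpTo_getD_zero (n : ℕ) : (wordsUpTo α n).getD 0 [] = [] := by
  cases n <;> simp [wordsUpTo]

theorem primrec_wordsUpTo [Primcodable α] : Primrec (wordsUpTo α) := by
  have h : Primrec₂ fun (_ : ℕ) (l : List (List α)) =>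
      [] :: l.flatMap fun w => (Finset.univ : Finset α).toList.map fun a => a :: w := by
    refine Primrec.list_cons.comp (Primrec.const []) ?_
    refine Primrec.list_flatMap Primrec.snd ?_
    refine Primrec.list_map (Primrec.const _) ?_
    exact Primrec.list_cons.comp Primrec.snd (Primrec.snd.comp Primrec.fst)
  refine (Primrec.nat_rec₁ [ [] ] h).of_eq fun n => ?_
  induction n with
  | zero => rfl
  | succ n ih => rw [wordsUpTo, ← ih]

end Words

theorem lookup_map_of_mem {α β γ : Type} [BEq β] [LawfulBEq β] {g : α → β}
    (hg : Function.Injective g) (f : α → γ) {x : α} {l : List α} (hx : x ∈ l) :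
    (l.map fun y => (g y, f y)).lookup (g x) = some (f x) := by
  induction l with
  | nil => simp at hx
  | cons y l ih =>
    rw [List.map_cons, List.lookup_cons]
    by_cases h : x = y
    · subst h
      simp
    · have h1 : (g x == g y) = false := beq_false_of_ne (hg.ne h)
      rw [h1]
      exact ih ((List.mem_cons.1 hx).resolve_left h)

/-! ### Construction of an automaton from a membership test -/

section Synthesis

variable {b d : ℕ}

open Classical in
/-- The number of the first word in a list that cannot be distinguished from `w` by a word in the
list. -/
noncomputable def wordState {α : Type} (W : List (List α)) (p : List α → Prop) (w : List α) : ℕ :=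
  W.findIdx fun u => decide (∀ t ∈ W, (p (u ++ t) ↔ p (w ++ t)))

open Classical in
/-- The automaton whose states are numbers of words in the list `W`. -/
noncomputable def codeOfWords (W : List (List (Padded (Digits b) d)))
    (p : List (Padded (Digits b) d) → Prop) : DFACode b d :=
  (W.length,
    ((List.range (W.length + 1)).flatMap fun q =>
      (Finset.univ : Finset (Padded (Digits b) d)).toList.map fun a => (q, a)).map
        fun x => ((x.1, x.2.1), wordState W p (W.getD x.1 [] ++ [x.2])),
    (List.range (W.length + 1)).filter fun q => decide (p (W.getD q [])))

theorem codeOfWords_step (W : List (List (Padded (Digits b) d)))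
    (p : List (Padded (Digits b) d) → Prop) (q : Fin ((codeOfWords W p).1 + 1)) (a : Padded (Digits b) d) :
    ((codeOfWords W p).toDFA.step q a : ℕ) = wordState W p (W.getD q [] ++ [a]) := by
  have hinj : Function.Injective fun x : ℕ × Padded (Digits b) d => (x.1, x.2.1) := by
    rintro ⟨q, a⟩ ⟨q', a'⟩ h
    obtain ⟨h1, h2⟩ := Prod.ext_iff.1 h
    exact Prod.ext h1 (Subtype.ext h2)
  have h := lookup_map_of_mem hinj
    (fun x : ℕ × Padded (Digits b) d => wordState W p (W.getD x.1 [] ++ [x.2]))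
    (x := ((q : ℕ), a)) (l := (List.range (W.length + 1)).flatMap fun q =>
      (Finset.univ : Finset (Padded (Digits b) d)).toList.map fun a => (q, a)) (by
      have hq : (q : ℕ) < W.length + 1 := q.2
      simpa [Nat.lt_succ_iff] using hq)
  have h2 : ((codeOfWords W p).toDFA.step q a : ℕ) =
      ((codeOfWords W p).2.1.lookup ((q : ℕ), a.1)).getD 0 % (W.length + 1) := rfl
  refine (h2.trans (congrArg (fun o => Option.getD o 0 % (W.length + 1)) h)).trans ?_
  -- The reduction modulo `W.length + 1` in `toDFA` is harmless: `findIdx` never exceeds the length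
  -- of the list.
  rw [Option.getD_some, Nat.mod_eq_of_lt]
  exact Nat.lt_succ_of_le List.findIdx_le_length

-- Myhill–Nerode with finite samples: if `W` represents every left quotient and its words separate
-- distinct quotients, the comparison in `wordState` identifies exactly the words with the same
-- quotient. The empty word must come first because the initial state is `0`.
open Classical in
theorem codeOfWords_recognizes {W : List (List (Padded (Digits b) d))}
    {L : Language (Padded (Digits b) d)} (h0 : W.getD 0 [] = [])
    (hW : ∀ w, ∃ u ∈ W, ∀ t, (u ++ t ∈ L ↔ w ++ t ∈ L))
    (htest : ∀ u w, (∀ t ∈ W, (u ++ t ∈ L ↔ w ++ t ∈ L)) → ∀ t, (u ++ t ∈ L ↔ w ++ t ∈ L)) :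
    DFACode.Recognizes (codeOfWords W (· ∈ L)) L := by
  have hstate : ∀ w t, W.getD (wordState W (· ∈ L) w) [] ++ t ∈ L ↔ w ++ t ∈ L := by
    intro w
    obtain ⟨u, hu, hut⟩ := hW w
    have hlt : wordState W (· ∈ L) w < W.length := by
      refine List.findIdx_lt_length_of_exists ⟨u, hu, ?_⟩
      exact decide_eq_true fun t _ => hut t
    have := List.findIdx_getElem (w := hlt)
    rw [List.getD_eq_getElem _ _ hlt]
    exact htest _ _ (of_decide_eq_true this)
  have heval : ∀ (w : List (Padded (Digits b) d)) (q : Fin ((codeOfWords W (· ∈ L)).1 + 1)) (v),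
      (∀ t, (W.getD q [] ++ t ∈ L ↔ v ++ t ∈ L)) → ∀ t,
      (W.getD ((codeOfWords W (· ∈ L)).toDFA.evalFrom q w) [] ++ t ∈ L ↔
        v ++ w ++ t ∈ L) := by
    intro w
    induction w with
    | nil => intro q v h t; rw [DFA.evalFrom_nil, List.append_nil]; exact h t
    | cons a w ih =>
      intro q v h t
      rw [DFA.evalFrom_cons]
      rw [show v ++ a :: w = v ++ [a] ++ w by simp]
      refine ih _ (v ++ [a]) (fun t => ?_) t
      rw [codeOfWords_step, hstate, List.append_assoc, h, List.append_assoc]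
  ext w
  have h1 := heval w 0 [] (fun t => by
    rw [Fin.val_zero, h0]) []
  simp only [List.append_nil, List.nil_append] at h1
  rw [← h1]
  have h2 : w ∈ (codeOfWords W (· ∈ L)).toDFA.accepts ↔
      ((codeOfWords W (· ∈ L)).toDFA.evalFrom 0 w : ℕ) ∈ (codeOfWords W (· ∈ L)).2.2 := Iff.rfl
  rw [h2]
  generalize (codeOfWords W (· ∈ L)).toDFA.evalFrom 0 w = q
  have h3 : (q : ℕ) < W.length + 1 := q.2
  simp only [codeOfWords, List.mem_filter, List.mem_range, decide_eq_true_eq]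
  exact and_iff_right h3

/-- Cutting factors by `f` finds representatives of length at most `card S`. A word that separates
`u` and `w` is shortened by tracking the pair of classes of `u ++ t` and `w ++ t`, which costs the
square. -/
theorem codeOfWords_wordsUpTo_recognizes {S : Type} [Fintype S]
    (f : List (Padded (Digits b) d) → S) {L : Language (Padded (Digits b) d)}
    (hf : ∀ u v t, f u = f v → u ++ t ∈ L → v ++ t ∈ L) {D : ℕ} (hD : Fintype.card S ^ 2 ≤ D) :
    DFACode.Recognizes (codeOfWords (wordsUpTo _ D) (· ∈ L)) L := by
  have hf' : ∀ u v, f u = f v → ∀ t, (u ++ t ∈ L ↔ v ++ t ∈ L) := fun u v h t =>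
    ⟨hf u v t h, hf v u t h.symm⟩
  refine codeOfWords_recognizes (wordsUpTo_getD_zero _ D) (fun w => ?_) (fun u w h t => ?_)
  · obtain ⟨u, hu, hut⟩ := exists_length_le_card f
      (p := fun u => ∀ t, (u ++ t ∈ L ↔ w ++ t ∈ L)) (fun u v t h h' t' => by
        rw [← h' t', List.append_assoc, List.append_assoc, hf' u v h]) (t := w) fun _ => Iff.rfl
    refine ⟨u, (mem_wordsUpTo _).2 (hu.trans ((Nat.le_self_pow two_ne_zero _).trans hD)), hut⟩
  · by_contra hne
    obtain ⟨t', ht', hne'⟩ := exists_length_le_card (fun t => (f (u ++ t), f (w ++ t)))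
      (p := fun t => ¬ (u ++ t ∈ L ↔ w ++ t ∈ L)) (fun s s' r h h' => by
        have h1 := hf' _ _ (congrArg Prod.fst h) r
        have h2 := hf' _ _ (congrArg Prod.snd h) r
        simp only [List.append_assoc] at h1 h2
        rwa [← h1, ← h2]) (t := t) hne
    refine hne' (h t' ((mem_wordsUpTo _).2 (ht'.trans (le_trans (le_of_eq ?_) hD))))
    rw [Fintype.card_prod, sq]

theorem exists_code_recognizes_of_isRegular {L : Language (Padded (Digits b) d)}
    (h : L.IsRegular) : ∃ C : DFACode b d, C.Recognizes L := by
  obtain ⟨S, _, M, rfl⟩ := h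
  refine ⟨_, codeOfWords_wordsUpTo_recognizes M.eval (fun u v t h hu => ?_) le_rfl⟩
  rw [DFA.mem_accepts] at hu ⊢
  rw [DFA.eval, DFA.evalFrom_of_append] at hu ⊢
  change M.evalFrom (M.eval v) t ∈ M.accept
  rw [← h]
  exact hu

theorem isRegular_of_recognizes {C : DFACode b d} {L : Language (Padded (Digits b) d)}
    (h : C.Recognizes L) : L.IsRegular :=
  ⟨_, inferInstance, C.toDFA, h⟩

/-- An arbitrary numbering suffices, since every function on a finite alphabet is primitive
recursive. -/
noncomputable instance : Primcodable (Padded (Digits b) d) :=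
  Primcodable.ofEquiv _ (Fintype.equivFin _)

-- Given a test that is primitive recursive uniformly in a parameter, the merging of words, the
-- transition table and the accepting states only use bounded loops over the list of words.
open Classical in
theorem primrec_codeOfWords {γ : Type} [Primcodable γ]
    {p : γ → List (Padded (Digits b) d) → Prop} (hp : PrimrecRel p) {D : γ → ℕ} (hD : Primrec D) :
    Primrec fun c => codeOfWords (wordsUpTo _ (D c)) (p c) := by
  have hW : Primrec fun c => wordsUpTo (Padded (Digits b) d) (D c) :=
    (primrec_wordsUpTo _).comp hD
  have hpd : Primrec fun x : γ × List (Padded (Digits b) d) => decide (p x.1 x.2) :=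
    PrimrecPred.decide hp
  have hrel : PrimrecRel fun (t : List (Padded (Digits b) d))
      (x : (γ × List (Padded (Digits b) d)) × List (Padded (Digits b) d)) =>
      (p x.1.1 (x.2 ++ t) ↔ p x.1.1 (x.1.2 ++ t)) := by
    have h1 : Primrec fun y : List (Padded (Digits b) d) ×
        ((γ × List (Padded (Digits b) d)) × List (Padded (Digits b) d)) =>
        decide (p y.2.1.1 (y.2.2 ++ y.1)) :=
      hpd.comp (Primrec.pair (Primrec.fst.comp (Primrec.fst.comp Primrec.snd))
        (Primrec.list_append.comp (Primrec.snd.comp Primrec.snd) Primrec.fst))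
    have h2 : Primrec fun y : List (Padded (Digits b) d) ×
        ((γ × List (Padded (Digits b) d)) × List (Padded (Digits b) d)) =>
        decide (p y.2.1.1 (y.2.1.2 ++ y.1)) :=
      hpd.comp (Primrec.pair (Primrec.fst.comp (Primrec.fst.comp Primrec.snd))
        (Primrec.list_append.comp (Primrec.snd.comp (Primrec.fst.comp Primrec.snd)) Primrec.fst))
    refine PrimrecPred.of_eq (Primrec.eq.comp h1 h2) fun y => ?_
    exact decide_eq_decide
  have hall : PrimrecRel fun (x : γ × List (Padded (Digits b) d))
      (u : List (Padded (Digits b) d)) => ∀ t ∈ wordsUpTo (Padded (Digits b) d) (D x.1),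
      (p x.1 (u ++ t) ↔ p x.1 (x.2 ++ t)) :=
    hrel.forall_mem_list.comp (hW.comp (Primrec.fst.comp Primrec.fst)) Primrec.id
  have hstate : Primrec fun x : γ × List (Padded (Digits b) d) =>
      wordState (wordsUpTo (Padded (Digits b) d) (D x.1)) (p x.1) x.2 :=
    Primrec.list_findIdx (hW.comp Primrec.fst) (PrimrecPred.decide hall)
  have hrange : Primrec fun c => List.range ((wordsUpTo (Padded (Digits b) d) (D c)).length + 1) :=
    Primrec.list_range.comp (Primrec.succ.comp (Primrec.list_length.comp hW))
  have hget : Primrec fun x : γ × ℕ => (wordsUpTo (Padded (Digits b) d) (D x.1)).getD x.2 [] :=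
    (Primrec.list_getD []).comp (hW.comp Primrec.fst) Primrec.snd
  refine Primrec.pair (Primrec.list_length.comp hW) (Primrec.pair ?_ ?_)
  · refine Primrec.list_map (Primrec.list_flatMap hrange ?_) ?_
    · refine Primrec.list_map (Primrec.const _) ?_
      exact Primrec.pair (Primrec.snd.comp Primrec.fst) Primrec.snd
    · refine Primrec.pair (Primrec.pair (Primrec.fst.comp Primrec.snd) ?_) ?_
      · exact (Primrec.dom_finite fun a : Padded (Digits b) d => a.1).comp
          (Primrec.snd.comp Primrec.snd)
      · refine hstate.comp (Primrec.pair Primrec.fst ?_)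
        exact Primrec.list_concat.comp
          (hget.comp (Primrec.pair Primrec.fst (Primrec.fst.comp Primrec.snd)))
          (Primrec.snd.comp Primrec.snd)
  · have hfil : PrimrecRel fun (q : ℕ) (c : γ) =>
        p c ((wordsUpTo (Padded (Digits b) d) (D c)).getD q []) :=
      PrimrecPred.comp (p := fun x : γ × List (Padded (Digits b) d) => p x.1 x.2) hp
        (Primrec.pair Primrec.snd (hget.comp (Primrec.pair Primrec.snd Primrec.fst)))
    exact hfil.listFilter.comp hrange Primrec.id

end Synthesis

end HMesh

namespace HMesh

/-! ### Evaluation of codes of automata on grid vectors -/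

section Evaluation

variable {b d : ℕ} [NeZero b]

/-- The symbol at position `p` of the word of the vector `(x - y) / 2 ^ L`, for natural numbers
`x j` and `y`. -/
def natSymbol (b : ℕ) [NeZero b] {d : ℕ} (L : ℕ) (x : Fin d → ℕ) (y p : ℕ) :
    Fin d → Option (Digits b) :=
  fun j => digitSymbol b L (decide (x j < y)) (x j - y + (y - x j)) p

theorem natSymbol_eq_gridSymbol (L : ℕ) (x : Fin d → ℕ) (y p : ℕ) :
    natSymbol b L x y p = gridSymbol b L (fun j => (x j : ℤ) - y) p := by
  funext j
  rw [natSymbol, gridSymbol]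
  have h1 : decide (x j < y) = decide ((x j : ℤ) - y < 0) := decide_eq_decide.2 (by omega)
  -- One of the two truncated differences is always zero.
  have h2 : x j - y + (y - x j) = ((x j : ℤ) - y).natAbs := by omega
  rw [h1, h2]

/-- For `i ≥ L + c` the power `b ^ i` exceeds `c` and is divisible by `2 ^ L`, so the word has
ended. This bounds the length of a run by the size of the numerators. -/
theorem gridSymbol_eq_none [hb : Fact (2 ∣ b)] {L c p : ℕ} {k : Fin d → ℤ}
    (hk : ∀ j, (k j).natAbs ≤ c) (hp : L + c < p) : gridSymbol b L k p = fun _ => none := by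
  funext j
  obtain ⟨i, rfl⟩ := Nat.exists_eq_succ_of_ne_zero (Nat.ne_of_gt (Nat.zero_lt_of_lt hp))
  have hb0 : 0 < b := Nat.pos_of_ne_zero (NeZero.ne b)
  rw [gridSymbol, digitSymbol, if_pos]
  refine ⟨?_, Nat.mod_eq_zero_of_dvd ?_⟩
  · calc (k j).natAbs ≤ c := hk j
      _ ≤ i := by omega
      _ < b ^ i := Nat.lt_pow_self (two_le_base b)
      _ ≤ b ^ i * 2 ^ L := Nat.le_mul_of_pos_right _ (by positivity)
  · exact ((pow_dvd_pow_of_dvd hb.out L).trans (pow_dvd_pow b (by omega))).mul_left _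

/-- The opposite bound, of the numerators by the length of the word, which makes the search for the
coded vector finite. -/
theorem natAbs_le_of_gridSymbol_eq_none {L p : ℕ} {k : Fin d → ℤ}
    (h : gridSymbol b L k p = fun _ => none) (j : Fin d) : (k j).natAbs ≤ 2 ^ L * b ^ p := by
  have hj := congrFun h j
  cases p with
  | zero => simp [gridSymbol, digitSymbol] at hj
  | succ i =>
    have hb0 : 0 < b := Nat.pos_of_ne_zero (NeZero.ne b)
    rw [gridSymbol, digitSymbol] at hj
    split_ifs at hj with h1
    refine h1.1.le.trans ?_
    rw [mul_comm]
    exact Nat.mul_le_mul_left _ (Nat.pow_le_pow_right hb0 (Nat.le_succ i))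

/-- One step of the automaton described by a code, on numbers of states. -/
def codeStep (C : DFACode b d) (q : ℕ) (a : Fin d → Option (Digits b)) : ℕ :=
  if a = (fun _ => none) then q else (C.2.1.lookup (q, a)).getD 0 % (C.1 + 1)

theorem stepPadded_toDFA {b d : ℕ} (C : DFACode b d) (q : Fin (C.1 + 1)) (a : Fin d → Option (Digits b)) :
    ((stepPadded C.toDFA q a : Fin (C.1 + 1)) : ℕ) = codeStep C q a := by
  rw [stepPadded, codeStep]
  by_cases h : ∃ j, a j ≠ none
  · rw [dif_pos h, if_neg (fun h' => by simp [h'] at h)]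
    rfl
  · rw [dif_neg h, if_pos]
    funext j
    by_contra hj
    exact h ⟨j, hj⟩

theorem foldl_codeStep {b d : ℕ} (C : DFACode b d) (q : Fin (C.1 + 1)) (s : ℕ → Fin d → Option (Digits b))
    (n : ℕ) : ((List.range n).map s).foldl (codeStep C) q =
      (runStream C.toDFA q s n : Fin (C.1 + 1)) := by
  induction n generalizing q s with
  | zero => rfl
  | succ n ih =>
    rw [List.range_succ_eq_map, List.map_cons, List.foldl_cons, ← stepPadded_toDFA, List.map_map,
      runStream, ← ih]
    rfl

/-- The automaton described by the code accepts the word of `(x - y) / 2 ^ L`, which is shorter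
than `B`. -/
def CodeAccepts (C : DFACode b d) (L B : ℕ) (x : Fin d → ℕ) (y : ℕ) : Prop :=
  ((List.range B).map (natSymbol b L x y)).foldl (codeStep C) 0 ∈ C.2.2

theorem codeAccepts_iff [Fact (2 ∣ b)] (C : DFACode b d) {L B c : ℕ} {x : Fin d → ℕ} {y : ℕ}
    (hx : ∀ j, x j ≤ c) (hy : y ≤ c) (hB : L + c < B) :
    CodeAccepts C L B x y ↔
      wordVec b (gridVec b L fun j => (x j : ℤ) - y) ∈ C.toDFA.accepts := by
  have h1 := foldl_codeStep C 0 (natSymbol b L x y) B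
  rw [Fin.val_zero] at h1
  rw [CodeAccepts, h1]
  have h2 : natSymbol b L x y = symbolAt (wordVec b (gridVec b L fun j => (x j : ℤ) - y)) := by
    funext p
    rw [natSymbol_eq_gridSymbol, symbolAt_wordVec_gridVec]
  rw [h2, runStream_symbolAt]
  · exact Iff.rfl
  · rw [← symbolAt_eq_none_iff, symbolAt_wordVec_gridVec]
    exact gridSymbol_eq_none (c := c) (fun j => by have := hx j; omega) hB

end Evaluation

/-! ### Recursiveness of the evaluation -/

section Recursive

variable {b d : ℕ} [NeZero b] {β : Type} [Primcodable β]

theorem primrec_pow {f g : β → ℕ} (hf : Primrec f) (hg : Primrec g) :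
    Primrec fun x => f x ^ g x :=
  Primrec₂.comp (Primrec₂.unpaired'.1 Nat.Primrec.pow) hf hg

theorem primrec_finOfNat {f : β → ℕ} (hf : Primrec f) : Primrec fun x => Fin.ofNat b (f x) :=
  Primrec.fin_val_iff.1 (Primrec.nat_mod.comp hf (Primrec.const b))

/-- A quantifier over a fixed finite set is a finite conjunction, so no uniformity in `i` is
required. Fixed `d` and `m` make this applicable to `I_m` and the sign patterns. -/
theorem primrecPred_forall_finset {ι : Type} (s : Finset ι) {p : ι → β → Prop}
    (hp : ∀ i, PrimrecPred (p i)) : PrimrecPred fun x => ∀ i ∈ s, p i x := by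
  classical
  induction s using Finset.induction_on with
  | empty => exact (Primrec.eq.comp (Primrec.const 0) (Primrec.const 0)).of_eq fun _ => by simp
  | insert i s _ ih =>
    refine ((hp i).and ih).of_eq fun x => ?_
    simp

theorem primrecPred_exists_finset {ι : Type} (s : Finset ι) {p : ι → β → Prop}
    (hp : ∀ i, PrimrecPred (p i)) : PrimrecPred fun x => ∃ i ∈ s, p i x := by
  refine (primrecPred_forall_finset s fun i => (hp i).not).not.of_eq fun x => ?_
  push Not
  rfl

theorem primrec_digitSymbol {L A p : β → ℕ} {s : β → Bool} (hL : Primrec L) (hs : Primrec s)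
    (hA : Primrec A) (hp : Primrec p) : Primrec fun x => digitSymbol b (L x) (s x) (A x) (p x) := by
  have h2L : Primrec fun x => 2 ^ L x := primrec_pow (Primrec.const 2) hL
  have hsgn : Primrec fun x => some (if s x then (Fin.ofNat b 1, Fin.ofNat b 1) else (0, 0)) :=
    Primrec.option_some.comp
      (Primrec.ite (Primrec.eq.comp hs (Primrec.const true)) (Primrec.const _) (Primrec.const _))
  have hbi : Primrec fun y : β × ℕ => b ^ y.2 := primrec_pow (Primrec.const b) Primrec.snd
  have hA' : Primrec fun y : β × ℕ => A y.1 := hA.comp Primrec.fst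
  have h2L' : Primrec fun y : β × ℕ => 2 ^ L y.1 := h2L.comp Primrec.fst
  have hdig : Primrec₂ fun (x : β) (i : ℕ) =>
      if A x < b ^ i * 2 ^ L x ∧ A x * b ^ i % 2 ^ L x = 0 then none
      else some (Fin.ofNat b (A x / 2 ^ L x / b ^ i),
        Fin.ofNat b (A x * b ^ (i + 1) / 2 ^ L x)) := by
    refine Primrec.ite ?_ (Primrec.const none) (Primrec.option_some.comp (Primrec.pair ?_ ?_))
    · refine PrimrecPred.and ?_ ?_
      · exact Primrec.nat_lt.comp hA' (Primrec.nat_mul.comp hbi h2L')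
      · exact Primrec.eq.comp (Primrec.nat_mod.comp (Primrec.nat_mul.comp hA' hbi) h2L')
          (Primrec.const 0)
    · exact primrec_finOfNat (Primrec.nat_div.comp (Primrec.nat_div.comp hA' h2L') hbi)
    · refine primrec_finOfNat (Primrec.nat_div.comp (Primrec.nat_mul.comp hA' ?_) h2L')
      exact primrec_pow (Primrec.const b) (Primrec.succ.comp Primrec.snd)
  refine (Primrec.nat_casesOn hp hsgn hdig).of_eq fun x => ?_
  cases p x <;> rfl

theorem primrec_natSymbol {L y p : β → ℕ} {X : β → Fin d → ℕ} (hL : Primrec L) (hX : Primrec X)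
    (hy : Primrec y) (hp : Primrec p) : Primrec fun x => natSymbol b (L x) (X x) (y x) (p x) := by
  refine Primrec.fin_curry.2 ?_
  have hX' : Primrec fun z : β × Fin d => X z.1 z.2 :=
    Primrec.fin_app.comp (hX.comp Primrec.fst) Primrec.snd
  have hy' : Primrec fun z : β × Fin d => y z.1 := hy.comp Primrec.fst
  refine primrec_digitSymbol (hL.comp Primrec.fst) ?_ ?_ (hp.comp Primrec.fst)
  · exact PrimrecPred.decide (Primrec.nat_lt.comp hX' hy')
  · exact Primrec.nat_add.comp (Primrec.nat_sub.comp hX' hy') (Primrec.nat_sub.comp hy' hX')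

theorem primrec_codeStep {b d : ℕ} {C : β → DFACode b d} {q : β → ℕ} {a : β → Fin d → Option (Digits b)}
    (hC : Primrec C) (hq : Primrec q) (ha : Primrec a) :
    Primrec fun x => codeStep (C x) (q x) (a x) := by
  refine Primrec.ite (Primrec.eq.comp ha (Primrec.const _)) hq ?_
  refine Primrec.nat_mod.comp ?_ (Primrec.succ.comp (Primrec.fst.comp hC))
  refine Primrec.option_getD.comp ?_ (Primrec.const 0)
  have := (Primrec.listLookup (α := ℕ × (Fin d → Option (Digits b))) (β := ℕ)).comp
    (Primrec.pair hq ha) (Primrec.fst.comp (Primrec.snd.comp hC))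
  refine this.of_eq fun x => ?_
  congr 1
  -- The two lookups differ only in their lawful Boolean equality tests, which coincide.
  exact lawful_beq_subsingleton _ _

theorem primrecPred_codeAccepts {C : β → DFACode b d} {L B y : β → ℕ} {X : β → Fin d → ℕ}
    (hC : Primrec C) (hL : Primrec L) (hB : Primrec B) (hX : Primrec X) (hy : Primrec y) :
    PrimrecPred fun x => CodeAccepts (C x) (L x) (B x) (X x) (y x) := by
  have hlist : Primrec fun x => (List.range (B x)).map (natSymbol b (L x) (X x) (y x)) :=
    Primrec.list_map (Primrec.list_range.comp hB)
      (primrec_natSymbol (hL.comp Primrec.fst) (hX.comp Primrec.fst) (hy.comp Primrec.fst)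
        Primrec.snd)
  have hfold := Primrec.list_foldl hlist (Primrec.const 0)
    (h := fun x z => codeStep (C x) z.1 z.2)
    (primrec_codeStep (hC.comp Primrec.fst) (Primrec.fst.comp Primrec.snd)
      (Primrec.snd.comp Primrec.snd))
  have hmem : PrimrecRel fun (l : List ℕ) (n : ℕ) => ∃ a ∈ l, a = n :=
    PrimrecRel.exists_mem_list Primrec.eq
  refine (hmem.comp (Primrec.snd.comp (Primrec.snd.comp hC)) hfold).of_eq fun x => ?_
  simp [CodeAccepts]

end Recursive

end HMesh

namespace HMesh

/-! ### The languages of Kraft's selection, from codes of automata -/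

section Codes

variable {b d : ℕ} [NeZero b]

/-- The language that is obtained for the level `ℓ` if the languages `L_1, …, L_{N-1}` are those
of the automata in the list. -/
def kraftLangOfCodes [Fact (2 ∣ b)] (m : ℕ) (Ms : List (DFACode b d)) (ℓ : ℕ) :
    Language (Padded (Digits b) d) :=
  {w | ∃ k : Fin d → ℤ, (∀ j, Odd (k j)) ∧
    Selected m Ms.length ℓ (fun ℓ' k => wordVec b (gridVec b (ℓ + 1) k) ∈
      (DFACode.toDFA (Ms.getD ℓ' (0, [], []))).accepts) k ∧
    w = wordVec b (gridVec b (ℓ + 1) k)}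

theorem natAbs_le_of_mem_indexCube {m : ℕ} {τ : Fin d → ℤ} (h : τ ∈ indexCube d m) (j : Fin d) :
    (τ j).natAbs ≤ m := by
  rw [indexCube, Fintype.mem_piFinset] at h
  have hj := h j
  split_ifs at hj with hm
  · rw [Finset.mem_Icc] at hj
    omega
  · rw [Finset.mem_Icc] at hj
    rw [Nat.not_odd_iff_even] at hm
    obtain ⟨a, ha⟩ := hm
    omega

theorem selected_iff {m n ℓ : ℕ} {A : ℕ → (Fin d → ℤ) → Prop} {k : Fin d → ℤ} :
    Selected m n ℓ A k ↔
      (ℓ < n → ∃ τ ∈ indexCube d m, ¬ A ℓ (k + fun j => 2 * τ j)) ∧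
      (ℓ = 0 ∨ ∀ τ ∈ indexCube d m, ∃ ε : Fin d → Bool,
        A (ℓ - 1) (k + fun j => 2 * τ j + if ε j then 1 else -1)) := by
  refine and_congr Iff.rfl ?_
  have h : ∀ (τ : Fin d → ℤ) (ε : Fin d → Bool),
      (k + fun j => 2 * τ j + if ε j then 1 else -1) =
        fun j => k j + 2 * τ j + if ε j then 1 else -1 := fun τ ε => by
    funext j
    rw [add_assoc]
    rfl
  simp only [h]
  cases ℓ with
  | zero => simp
  | succ ℓ => simp

theorem natAbs_double_le {m : ℕ} {τ : Fin d → ℤ} (h : τ ∈ indexCube d m) (j : Fin d) :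
    (2 * τ j).natAbs ≤ 2 * m + 1 := by
  have := natAbs_le_of_mem_indexCube h j
  omega

theorem natAbs_double_add_sign_le {m : ℕ} {τ : Fin d → ℤ} (h : τ ∈ indexCube d m)
    (ε : Fin d → Bool) (j : Fin d) :
    (2 * τ j + if ε j then 1 else -1).natAbs ≤ 2 * m + 1 := by
  have := natAbs_le_of_mem_indexCube h j
  split_ifs <;> omega

/-! ### A test of membership -/

/-- A bound for the numerators of a vector whose word is given. -/
def radius (z : (List (DFACode b d) × ℕ) × List (Padded (Digits b) d)) : ℕ :=
  2 ^ (z.1.2 + 1) * b ^ z.2.length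

/-- The vectors of natural numbers up to twice the radius, numbered. -/
def coords (z : (List (DFACode b d) × ℕ) × List (Padded (Digits b) d)) (n : ℕ) : Fin d → ℕ :=
  fun j => n / (2 * radius z + 1) ^ (j : ℕ) % (2 * radius z + 1)

/-- A bound for the lengths of the words of the vectors in the membership test. -/
def lengthBound (m : ℕ) (z : (List (DFACode b d) × ℕ) × List (Padded (Digits b) d)) : ℕ :=
  z.1.2 + 1 + (2 * radius z + 2 * (2 * m + 1)) + 1

/-- The automaton with number `ℓ'` accepts the translate by `e` of the vector number `n`. -/
def AcceptsShift (m : ℕ) (z : (List (DFACode b d) × ℕ) × List (Padded (Digits b) d)) (n ℓ' : ℕ)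
    (e : Fin d → ℤ) : Prop :=
  CodeAccepts (z.1.1.getD ℓ' (0, [], [])) (z.1.2 + 1) (lengthBound m z)
    (fun j => coords z n j + (e j + (2 * m + 1)).toNat) (radius z + (2 * m + 1))

/-- The word is that of the vector number `n`, and it belongs to the language
`kraftLangOfCodes`. -/
def MembershipTest (m : ℕ) (z : (List (DFACode b d) × ℕ) × List (Padded (Digits b) d)) (n : ℕ) :
    Prop :=
  (∀ p < lengthBound m z,
    symbolAt z.2 p = natSymbol b (z.1.2 + 1) (coords z n) (radius z) p) ∧
  (∀ j ∈ (Finset.univ : Finset (Fin d)), (coords z n j + radius z) % 2 = 1) ∧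
  (¬ z.1.2 < z.1.1.length ∨
    ∃ τ ∈ indexCube d m, ¬ AcceptsShift m z n z.1.2 fun j => 2 * τ j) ∧
  (z.1.2 = 0 ∨ ∀ τ ∈ indexCube d m, ∃ ε ∈ (Finset.univ : Finset (Fin d → Bool)),
    AcceptsShift m z n (z.1.2 - 1) fun j => 2 * τ j + if ε j then 1 else -1)

theorem coords_le {b d : ℕ} (z : (List (DFACode b d) × ℕ) × List (Padded (Digits b) d)) (n : ℕ) (j : Fin d) :
    coords z n j ≤ 2 * radius z :=
  Nat.lt_succ_iff.1 (Nat.mod_lt _ (Nat.succ_pos _))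

theorem exists_coords_eq {b d : ℕ} (z : (List (DFACode b d) × ℕ) × List (Padded (Digits b) d))
    {x : Fin d → ℕ} (hx : ∀ j, x j ≤ 2 * radius z) :
    ∃ n < (2 * radius z + 1) ^ d, coords z n = x := by
  let y : Fin d → Fin (2 * radius z + 1) := fun j => ⟨x j, Nat.lt_succ_iff.2 (hx j)⟩
  refine ⟨finFunctionFinEquiv y, (finFunctionFinEquiv y).2, ?_⟩
  funext j
  have h := congrFun (finFunctionFinEquiv.symm_apply_apply y) j
  have h2 := congrArg Fin.val h
  exact h2

variable [Fact (2 ∣ b)]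

theorem acceptsShift_iff {m : ℕ} (z : (List (DFACode b d) × ℕ) × List (Padded (Digits b) d))
    (n ℓ' : ℕ) {e : Fin d → ℤ} (he : ∀ j, (e j).natAbs ≤ 2 * m + 1) :
    AcceptsShift m z n ℓ' e ↔
      wordVec b (gridVec b (z.1.2 + 1) ((fun j => (coords z n j : ℤ) - radius z) + e)) ∈
        (DFACode.toDFA (z.1.1.getD ℓ' (0, [], []))).accepts := by
  -- Raising both the coordinates and the subtrahend by `2 * m + 1` keeps the shifted vector
  -- natural. A coordinate is then at most `2 * radius z` plus twice this amount.
  rw [AcceptsShift, codeAccepts_iff (c := 2 * radius z + 2 * (2 * m + 1))]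
  · have h : (fun j => ((coords z n j + (e j + (2 * m + 1)).toNat : ℕ) : ℤ) -
        (radius z + (2 * m + 1) : ℕ)) = (fun j => (coords z n j : ℤ) - radius z) + e := by
      funext j
      have := he j
      simp only [Pi.add_apply]
      omega
    rw [h]
  · intro j
    have := he j
    have := coords_le z n j
    omega
  · omega
  · rw [lengthBound]
    omega

theorem membershipTest_iff {m : ℕ} (z : (List (DFACode b d) × ℕ) × List (Padded (Digits b) d))
    (n : ℕ) {k : Fin d → ℤ} (hk : ∀ j, k j = (coords z n j : ℤ) - radius z) :
    MembershipTest m z n ↔ z.2 = wordVec b (gridVec b (z.1.2 + 1) k) ∧ (∀ j, Odd (k j)) ∧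
      Selected m z.1.1.length z.1.2 (fun ℓ' k => wordVec b (gridVec b (z.1.2 + 1) k) ∈
        (DFACode.toDFA (z.1.1.getD ℓ' (0, [], []))).accepts) k := by
  obtain rfl : k = fun j => (coords z n j : ℤ) - radius z := funext hk
  rw [MembershipTest, selected_iff]
  refine and_congr ?_ (and_congr ?_ (and_congr ?_ ?_))
  · rw [eq_wordVec_gridVec_iff]
    constructor
    · intro h p
      by_cases hp : p < lengthBound m z
      · rw [h p hp, natSymbol_eq_gridSymbol]
      -- Beyond the bound both streams consist of `(⋄, …, ⋄)`, so the finite comparison is enough.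
      · rw [lengthBound] at hp
        have hlen : z.2.length ≤ p := by
          have h1 : z.2.length < b ^ z.2.length := Nat.lt_pow_self (two_le_base b)
          have h2 : b ^ z.2.length ≤ radius z := Nat.le_mul_of_pos_left _ (by positivity)
          omega
        rw [symbolAt_eq_none_iff.2 hlen, gridSymbol_eq_none (c := radius z)]
        · intro j
          have := coords_le z n j
          omega
        · omega
    · intro h p _
      rw [h p, natSymbol_eq_gridSymbol]
  · simp only [Finset.mem_univ, forall_true_left]
    refine forall_congr' fun j => ?_
    rw [Int.odd_iff]
    omega
  · rw [imp_iff_not_or]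
    refine or_congr Iff.rfl (exists_congr fun τ => and_congr_right fun hτ => not_congr ?_)
    exact acceptsShift_iff z n _ (natAbs_double_le hτ)
  · refine or_congr Iff.rfl (forall₂_congr fun τ hτ => ?_)
    simp only [Finset.mem_univ, true_and]
    exact exists_congr fun ε => acceptsShift_iff z n _ (natAbs_double_add_sign_le hτ ε)

/-- The given word bounds the numerators by the radius, and the vectors within this bound are
numbered by the base `2 * radius z + 1` digits of `n`, shifted by the radius. -/
theorem mem_kraftLangOfCodes_iff {m : ℕ}
    (z : (List (DFACode b d) × ℕ) × List (Padded (Digits b) d)) :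
    z.2 ∈ kraftLangOfCodes m z.1.1 z.1.2 ↔
      ∃ n < (2 * radius z + 1) ^ d, MembershipTest m z n := by
  constructor
  · rintro ⟨k, hodd, hsel, hw⟩
    -- The first position after the word carries `(⋄, …, ⋄)`.
    have hk : ∀ j, (k j).natAbs ≤ radius z := by
      refine natAbs_le_of_gridSymbol_eq_none ?_
      rw [← symbolAt_wordVec_gridVec, ← hw, symbolAt_eq_none_iff]
    obtain ⟨n, hn, hx⟩ := exists_coords_eq z (x := fun j => (k j + radius z).toNat) fun j => by
      have := hk j
      omega
    refine ⟨n, hn, (membershipTest_iff z n (k := k) fun j => ?_).2 ⟨hw, hodd, hsel⟩⟩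
    rw [hx]
    have := hk j
    dsimp only
    omega
  · rintro ⟨n, -, h⟩
    obtain ⟨hw, hodd, hsel⟩ := (membershipTest_iff z n fun _ => rfl).1 h
    exact ⟨_, hodd, hsel, hw⟩

end Codes

/-! ### Recursiveness of the membership test -/

section CodesRecursive

variable {b d : ℕ} [NeZero b]

theorem primrec_radius {b d : ℕ} : Primrec (radius (b := b) (d := d)) :=
  Primrec.nat_mul.comp
    (primrec_pow (Primrec.const 2) (Primrec.succ.comp (Primrec.snd.comp Primrec.fst)))
    (primrec_pow (Primrec.const b) (Primrec.list_length.comp Primrec.snd))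

theorem primrec_lengthBound {b d : ℕ} (m : ℕ) : Primrec (lengthBound (b := b) (d := d) m) :=
  Primrec.succ.comp (Primrec.nat_add.comp (Primrec.succ.comp (Primrec.snd.comp Primrec.fst))
    (Primrec.nat_add.comp (Primrec.nat_mul.comp (Primrec.const 2) primrec_radius)
      (Primrec.const _)))

theorem primrec_coords {b d : ℕ} :
    Primrec fun y : ((List (DFACode b d) × ℕ) × List (Padded (Digits b) d)) × ℕ =>
      coords y.1 y.2 := by
  refine Primrec.fin_curry.2 ?_
  have h : Primrec fun x : (((List (DFACode b d) × ℕ) × List (Padded (Digits b) d)) × ℕ) × Fin d =>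
      2 * radius x.1.1 + 1 :=
    Primrec.succ.comp (Primrec.nat_mul.comp (Primrec.const 2)
      (primrec_radius.comp (Primrec.fst.comp Primrec.fst)))
  exact Primrec.nat_mod.comp (Primrec.nat_div.comp (Primrec.snd.comp Primrec.fst)
    (primrec_pow h (Primrec.fin_val.comp Primrec.snd))) h

theorem primrecPred_acceptsShift (m : ℕ) (e : Fin d → ℤ)
    {f : (((List (DFACode b d) × ℕ) × List (Padded (Digits b) d)) × ℕ) → ℕ} (hf : Primrec f) :
    PrimrecPred fun y => AcceptsShift m y.1 y.2 (f y) e := by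
  refine primrecPred_codeAccepts ?_ ?_ ((primrec_lengthBound m).comp Primrec.fst) ?_ ?_
  · exact (Primrec.list_getD _).comp (Primrec.fst.comp (Primrec.fst.comp Primrec.fst)) hf
  · exact Primrec.succ.comp (Primrec.snd.comp (Primrec.fst.comp Primrec.fst))
  · refine Primrec.fin_curry.2 (Primrec.nat_add.comp ?_ ?_)
    · exact Primrec.fin_app.comp (primrec_coords.comp Primrec.fst) Primrec.snd
    · exact (Primrec.dom_finite fun j : Fin d => (e j + (2 * m + 1)).toNat).comp Primrec.snd
  · exact Primrec.nat_add.comp (primrec_radius.comp Primrec.fst) (Primrec.const _)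

theorem primrec_symbolAt {b d : ℕ} : Primrec₂ (symbolAt (σ := Digits b) (k := d)) :=
  (Primrec.list_getD _).comp
    (Primrec.list_map Primrec.fst
      ((Primrec.dom_finite fun a : Padded (Digits b) d => a.1).comp Primrec.snd)) Primrec.snd

theorem primrecPred_membershipTest (m : ℕ) :
    PrimrecPred fun y : ((List (DFACode b d) × ℕ) × List (Padded (Digits b) d)) × ℕ =>
      MembershipTest m y.1 y.2 := by
  have hℓ : Primrec fun y : ((List (DFACode b d) × ℕ) × List (Padded (Digits b) d)) × ℕ =>
      y.1.1.2 := Primrec.snd.comp (Primrec.fst.comp Primrec.fst)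
  have hlen : Primrec fun y : ((List (DFACode b d) × ℕ) × List (Padded (Digits b) d)) × ℕ =>
      y.1.1.1.length :=
    Primrec.list_length.comp (Primrec.fst.comp (Primrec.fst.comp Primrec.fst))
  refine PrimrecPred.and ?_ (PrimrecPred.and ?_ (PrimrecPred.and ?_ ?_))
  · have h : PrimrecRel fun (p : ℕ)
        (y : ((List (DFACode b d) × ℕ) × List (Padded (Digits b) d)) × ℕ) =>
        symbolAt y.1.2 p = natSymbol b (y.1.1.2 + 1) (coords y.1 y.2) (radius y.1) p :=
      Primrec.eq.comp
        (primrec_symbolAt.comp (Primrec.snd.comp (Primrec.fst.comp Primrec.snd)) Primrec.fst)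
        (primrec_natSymbol (Primrec.succ.comp (hℓ.comp Primrec.snd))
          (primrec_coords.comp Primrec.snd)
          (primrec_radius.comp (Primrec.fst.comp Primrec.snd)) Primrec.fst)
    exact (h.forall_mem_list.comp
      (Primrec.list_range.comp ((primrec_lengthBound m).comp Primrec.fst)) Primrec.id).of_eq
      fun y => by simp
  · refine primrecPred_forall_finset _ fun j => ?_
    exact Primrec.eq.comp (Primrec.nat_mod.comp (Primrec.nat_add.comp
      (Primrec.fin_app.comp primrec_coords (Primrec.const j))
      (primrec_radius.comp Primrec.fst)) (Primrec.const 2)) (Primrec.const 1)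
  · refine PrimrecPred.or (Primrec.nat_lt.comp hℓ hlen).not ?_
    exact primrecPred_exists_finset _ fun τ => (primrecPred_acceptsShift m _ hℓ).not
  · refine PrimrecPred.or (Primrec.eq.comp hℓ (Primrec.const 0)) ?_
    refine primrecPred_forall_finset _ fun τ => primrecPred_exists_finset _ fun ε => ?_
    exact primrecPred_acceptsShift m _ (Primrec.pred.comp hℓ)

theorem primrecRel_mem_kraftLangOfCodes [Fact (2 ∣ b)] (m : ℕ) :
    PrimrecRel fun (c : List (DFACode b d) × ℕ) (w : List (Padded (Digits b) d)) =>
      w ∈ kraftLangOfCodes m c.1 c.2 := by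
  have h1 : PrimrecRel fun (n : ℕ) (z : (List (DFACode b d) × ℕ) × List (Padded (Digits b) d)) =>
      MembershipTest m z n :=
    (primrecPred_membershipTest m).comp (Primrec.pair Primrec.snd Primrec.fst)
  have h2 : Primrec fun z : (List (DFACode b d) × ℕ) × List (Padded (Digits b) d) =>
      (2 * radius z + 1) ^ d :=
    primrec_pow (Primrec.succ.comp (Primrec.nat_mul.comp (Primrec.const 2) primrec_radius))
      (Primrec.const d)
  refine (h1.exists_mem_list.comp (Primrec.list_range.comp h2) Primrec.id).of_eq fun z => ?_
  simpa using (mem_kraftLangOfCodes_iff z).symm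

end CodesRecursive

/-! ### Finite index -/

/-- The product of two automata; the accepting states are irrelevant here. -/
def productDFA {α Q₁ Q₂ : Type} (M₁ : DFA α Q₁) (M₂ : DFA α Q₂) : DFA α (Q₁ × Q₂) where
  step q a := (M₁.step q.1 a, M₂.step q.2 a)
  start := (M₁.start, M₂.start)
  accept := ∅

theorem productDFA_eval {α Q₁ Q₂ : Type} (M₁ : DFA α Q₁) (M₂ : DFA α Q₂) (w : List α) :
    (productDFA M₁ M₂).eval w = (M₁.eval w, M₂.eval w) := by
  have h : ∀ (w : List α) (q : Q₁ × Q₂),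
      (productDFA M₁ M₂).evalFrom q w = (M₁.evalFrom q.1 w, M₂.evalFrom q.2 w) := by
    intro w
    induction w with
    | nil => intro q; rfl
    | cons a w ih => intro q; rw [DFA.evalFrom_cons, ih]; rfl
  exact h w _

/-- The vectors of integers of absolute value at most `2 * m + 1`. -/
abbrev Shift (d m : ℕ) : Type :=
  {e : Fin d → ℤ // e ∈ Fintype.piFinset fun _ : Fin d => Finset.Icc (-(2 * m + 1 : ℤ)) (2 * m + 1)}

section Index

variable {b d : ℕ} [NeZero b]

/-- A bound for the number of the left quotients of the language `kraftLangOfCodes`, squared. -/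
noncomputable def quotientBound (m : ℕ) (c : List (DFACode b d) × ℕ) : ℕ :=
  ((Fintype.card (Padded (Digits b) d) + 1) ^ (c.2 + 1 + (2 * m + 1) + 1) +
    2 ^ (3 ^ d * (2 ^ d * (((c.1.getD c.2 (0, [], [])).1 + 1) *
      ((c.1.getD (c.2 - 1) (0, [], [])).1 + 1) * 3 ^ d) ^ Fintype.card (Shift d m)))) ^ 2

theorem primrec_quotientBound {b d : ℕ} (m : ℕ) : Primrec (quotientBound (b := b) (d := d) m) := by
  have h : ∀ {f : List (DFACode b d) × ℕ → ℕ}, Primrec f →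
      Primrec fun c : List (DFACode b d) × ℕ => (c.1.getD (f c) (0, [], [])).1 + 1 := fun hf =>
    Primrec.succ.comp (Primrec.fst.comp ((Primrec.list_getD _).comp Primrec.fst hf))
  refine primrec_pow (Primrec.nat_add.comp ?_ ?_) (Primrec.const 2)
  · refine primrec_pow (Primrec.const _) (Primrec.succ.comp (Primrec.nat_add.comp ?_
      (Primrec.const _)))
    exact Primrec.succ.comp Primrec.snd
  · refine primrec_pow (Primrec.const 2) (Primrec.nat_mul.comp (Primrec.const _)
      (Primrec.nat_mul.comp (Primrec.const _) (primrec_pow ?_ (Primrec.const _))))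
    exact Primrec.nat_mul.comp (Primrec.nat_mul.comp (h Primrec.snd)
      (h (Primrec.pred.comp Primrec.snd))) (Primrec.const _)

variable [Fact (2 ∣ b)]

/-- Selection at level `ℓ` consults only the languages of `Ω^(ℓ+1)` and `Ω^ℓ`, so one product
automaton carries all the needed states. For `ℓ = 0` its second factor is present but never
consulted. -/
theorem kraftLangOfCodes_eq_translateLang (m : ℕ) (Ms : List (DFACode b d)) (ℓ : ℕ) :
    ∃ R, kraftLangOfCodes m Ms ℓ = translateLang (ℓ + 1)
      (productDFA (DFACode.toDFA (Ms.getD ℓ (0, [], [])))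
        (DFACode.toDFA (Ms.getD (ℓ - 1) (0, [], [])))) (fun e : Shift d m => e.1) R := by
  have hmem : ∀ {e : Fin d → ℤ}, (∀ j, (e j).natAbs ≤ 2 * m + 1) →
      e ∈ Fintype.piFinset fun _ : Fin d => Finset.Icc (-(2 * m + 1 : ℤ)) (2 * m + 1) := by
    intro e he
    refine Fintype.mem_piFinset.2 fun j => Finset.mem_Icc.2 ?_
    have := he j
    omega
  refine ⟨fun q =>
    (ℓ < Ms.length → ∃ τ ∈ indexCube d m, ∃ e : Shift d m, e.1 = (fun j => 2 * τ j) ∧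
      (q e).1 ∉ (DFACode.toDFA (Ms.getD ℓ (0, [], []))).accept) ∧
    (ℓ = 0 ∨ ∀ τ ∈ indexCube d m, ∃ ε : Fin d → Bool, ∃ e : Shift d m,
      e.1 = (fun j => 2 * τ j + if ε j then 1 else -1) ∧
      (q e).2 ∈ (DFACode.toDFA (Ms.getD (ℓ - 1) (0, [], []))).accept), ?_⟩
  ext w
  refine exists_congr fun k => and_congr_right fun _ => and_congr_left fun _ => ?_
  rw [selected_iff]
  refine and_congr (imp_congr Iff.rfl (exists_congr fun τ => and_congr_right fun hτ => ?_))
    (or_congr Iff.rfl (forall₂_congr fun τ hτ => exists_congr fun ε => ?_))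
  · simp only [productDFA_eval]
    constructor
    · intro h
      exact ⟨⟨_, hmem (natAbs_double_le hτ)⟩, rfl, h⟩
    · rintro ⟨⟨_, _⟩, rfl, h⟩
      exact h
  · simp only [productDFA_eval]
    constructor
    · intro h
      exact ⟨⟨_, hmem (natAbs_double_add_sign_le hτ ε)⟩, rfl, h⟩
    · rintro ⟨⟨_, _⟩, rfl, h⟩
      exact h

open Classical in
theorem recognizes_kraftLangOfCodes (m : ℕ) (c : List (DFACode b d) × ℕ) :
    DFACode.Recognizes
      (codeOfWords (wordsUpTo _ (quotientBound m c)) (· ∈ kraftLangOfCodes m c.1 c.2))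
      (kraftLangOfCodes m c.1 c.2) := by
  obtain ⟨R, hR⟩ := kraftLangOfCodes_eq_translateLang m c.1 c.2
  have hb := two_le_base b
  -- The threshold `ℓ + 1 + (2 * m + 1)` is at least the exponent `ℓ + 1`, so the tails are
  -- integral, and it makes `b ^ n₀` exceed every shift.
  refine codeOfWords_wordsUpTo_recognizes
    (prefixClass (c.2 + 1) (c.2 + 1 + (2 * m + 1))
      (productDFA (DFACode.toDFA (c.1.getD c.2 (0, [], [])))
        (DFACode.toDFA (c.1.getD (c.2 - 1) (0, [], [])))) fun e : Shift d m => e.1) ?_ ?_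
  · intro u v t h hu
    rw [hR] at hu ⊢
    refine append_mem_translateLang_of_prefixClass_eq (Nat.succ_pos _) (Nat.le_add_right _ _) ?_
      h hu
    rintro ⟨e, he⟩ j
    have h1 := Finset.mem_Icc.1 (Fintype.mem_piFinset.1 he j)
    calc (e j).natAbs ≤ c.2 + 1 + (2 * m + 1) := by omega
      _ < b ^ (c.2 + 1 + (2 * m + 1)) := Nat.lt_pow_self hb
      _ ≤ 2 ^ (c.2 + 1) * b ^ (c.2 + 1 + (2 * m + 1)) :=
        Nat.le_mul_of_pos_left _ (by positivity)
  · rw [← Nat.card_eq_fintype_card, card_prefixClass, Fintype.card_prod, Fintype.card_fin, Fintype.card_fin]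
    exact le_rfl

/-- Codes of automata for the languages of Kraft's selection. -/
noncomputable def kraftCodes (m : ℕ) (Ms : List (DFACode b d)) : List (DFACode b d) :=
  (List.range (Ms.length + 1)).map fun ℓ =>
    codeOfWords (wordsUpTo _ (quotientBound m (Ms, ℓ))) (· ∈ kraftLangOfCodes m Ms ℓ)

theorem computable_kraftCodes (m : ℕ) : Computable (kraftCodes (b := b) (d := d) m) := by
  refine Primrec.to_comp (Primrec.list_map
    (Primrec.list_range.comp (Primrec.succ.comp Primrec.list_length)) ?_)
  exact primrec_codeOfWords (primrecRel_mem_kraftLangOfCodes m) (primrec_quotientBound m)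

/-- The codes are defined for arbitrary lists of automata, so the algorithm is total; only here are
the automata tied to a mesh. The guards in `Selected` ensure that no automaton outside the list is
consulted. -/
theorem kraftLang_eq_kraftLangOfCodes {N m ℓ : ℕ} (T : HierarchicalMesh d N)
    {Ms : List (DFACode b d)} (hN : Ms.length + 1 = N)
    (hMs : ∀ (ℓ : ℕ) (h : ℓ < Ms.length), DFACode.Recognizes Ms[ℓ] (T.domainLang b ℓ))
    (hℓ : ℓ < N) : T.kraftLang b m ℓ = kraftLangOfCodes m Ms ℓ := by
  have hrec : ∀ ℓ' < Ms.length,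
      (DFACode.toDFA (Ms.getD ℓ' (0, [], []))).accepts = T.domainLang b ℓ' := by
    intro ℓ' h
    rw [List.getD_eq_getElem _ _ h]
    exact hMs ℓ' h
  have hsel : ∀ k : Fin d → ℤ,
      Selected m (N - 1) ℓ (fun ℓ' k => wordVec b (gridVec b (ℓ + 1) k) ∈ T.domainLang b ℓ') k ↔
      Selected m Ms.length ℓ (fun ℓ' k => wordVec b (gridVec b (ℓ + 1) k) ∈
        (DFACode.toDFA (Ms.getD ℓ' (0, [], []))).accepts) k := by
    intro k
    have hN' : N - 1 = Ms.length := by omega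
    rw [hN']
    refine and_congr (forall_congr' fun h => ?_) (forall₂_congr fun ℓ' h => ?_)
    · simp only [hrec ℓ h]
    · simp only [hrec ℓ' (by omega)]
  rw [T.kraftLang_eq hℓ]
  ext w
  constructor
  · rintro ⟨c, hc, rfl⟩
    exact ⟨_, fun j => odd_two_mul_add_one (c j), (hsel _).1 hc, rfl⟩
  · rintro ⟨k, hodd, hk, rfl⟩
    choose c hc using hodd
    obtain rfl : k = fun j => 2 * c j + 1 := funext hc
    exact ⟨c, (hsel _).2 hk, rfl⟩

theorem recognizes_kraftCodes {N m : ℕ} (T : HierarchicalMesh d N)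
    {Ms : List (DFACode b d)} (hN : Ms.length + 1 = N)
    (hMs : ∀ (ℓ : ℕ) (h : ℓ < Ms.length), DFACode.Recognizes Ms[ℓ] (T.domainLang b ℓ)) :
    (kraftCodes m Ms).length = N ∧ ∀ (ℓ : ℕ) (h : ℓ < (kraftCodes m Ms).length),
      DFACode.Recognizes (kraftCodes m Ms)[ℓ] (T.kraftLang b m ℓ) := by
  have hlen : (kraftCodes m Ms).length = N := by simp [kraftCodes, hN]
  refine ⟨hlen, fun ℓ h => ?_⟩
  rw [kraftLang_eq_kraftLangOfCodes T hN hMs (hlen ▸ h)]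
  have : (kraftCodes m Ms)[ℓ] = codeOfWords (wordsUpTo _ (quotientBound m (Ms, ℓ)))
      (· ∈ kraftLangOfCodes m Ms ℓ) := by
    simp [kraftCodes]
  rw [this]
  exact recognizes_kraftLangOfCodes m (Ms, ℓ)

/-- Each regular domain language has some code, and the algorithm applied to a choice of codes
yields automata for all levels. -/
theorem kraftLang_isRegular {N m : ℕ} (T : HierarchicalMesh d N) (hT : T.IsRegular b) {ℓ : ℕ}
    (hℓ : ℓ < N) : (T.kraftLang b m ℓ).IsRegular := by
  have hC : ∀ ℓ : Fin (N - 1), ∃ C : DFACode b d, C.Recognizes (T.domainLang b ℓ) := fun ℓ =>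
    exists_code_recognizes_of_isRegular (hT ℓ (by omega))
  choose C hC using hC
  obtain ⟨h1, h2⟩ := recognizes_kraftCodes (m := m) T (Ms := List.ofFn C)
    (by rw [List.length_ofFn]; omega) fun ℓ h => by
      rw [List.getElem_ofFn]
      exact hC _
  exact isRegular_of_recognizes (h2 ℓ (h1.symm ▸ hℓ))

end Index

end HMesh

theorem theorem5 (b d m : ℕ) [NeZero b] [Fact (2 ∣ b)] (hd : 0 < d) :
    -- the languages are defined by the formulas, and are regular for a regular mesh
    (∀ (N : ℕ) (T : HierarchicalMesh d N),
      (∀ ℓ, ℓ + 1 < N → T.kraftLang b m ℓ = HMesh.definedLang b T (HMesh.Theta d m ℓ)) ∧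
      T.kraftLang b m (N - 1) = HMesh.definedLang b T (HMesh.Gamma d m (N - 1)) ∧
      (T.IsRegular b → ∀ ℓ, ℓ < N → (T.kraftLang b m ℓ).IsRegular)) ∧
    -- an algorithm turns automata for `L_1, …, L_{N-1}` into automata for `L̂_0, …, L̂_{N-1}`
    (∃ F : List (HMesh.DFACode b d) → List (HMesh.DFACode b d), Computable F ∧
      ∀ (N : ℕ) (T : HierarchicalMesh d N) (Ms : List (HMesh.DFACode b d)),
        Ms.length + 1 = N →
        (∀ (ℓ : ℕ) (h : ℓ < Ms.length), HMesh.DFACode.Recognizes Ms[ℓ] (T.domainLang b ℓ)) →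
        (F Ms).length = N ∧
        ∀ (ℓ : ℕ) (h : ℓ < (F Ms).length),
          HMesh.DFACode.Recognizes (F Ms)[ℓ] (T.kraftLang b m ℓ)) :=
  ⟨fun _ T => ⟨fun _ hℓ => HMesh.kraftLang_eq_definedLang_Theta T hℓ,
      HMesh.kraftLang_eq_definedLang_Gamma T, fun hT _ hℓ => HMesh.kraftLang_isRegular T hT hℓ⟩,
    HMesh.kraftCodes m, HMesh.computable_kraftCodes m,
    fun _ T _ hN hMs => HMesh.recognizes_kraftCodes T hN hMs⟩
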